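/- Algebraic set-up. Let $\tilde G$ be a Lie group with Lie algebra $\tilde{\mathfrak g}\cong\mathfrak{so}(p+1,q+1)$ and let $\tilde P\subset\tilde G$ be a closed subgroup whose Lie algebra $\tilde{\mathfrak p}$ is the stabiliser in $\mathfrak{so}(p+1,q+1)$ of a null line $\ell\subset\mathbb R^{p+1,q+1}$ (for instance the stabiliser in $\tilde G$ of $\ell$, or of a ray in $\ell$). Let $i:G\hookrightarrow\tilde G$ be an inclusion of Lie groups with $G$ semisimple (i.e. its Lie algebra $\mathfrak g$ is semisimple), write $Q=i^{-1}(\tilde P)$ and $o=e\tilde P\in\tilde G/\tilde P$, and assume that the orbit $G\cdot o$ is open in $\tilde G/\tilde P$. Let $P\subset G$ be a parabolic subgroup containing $Q$: a closed subgroup with Lie algebra $\mathfrak p=\bigoplus_{j\ge 0}\mathfrak g_j$ for a $|k|$-grading $\mathfrak g=\bigoplus_{j=-k}^{k}\mathfrak g_j$ whose negative part is generated by $\mathfrak g_{-1}$; put $\mathfrak g^j=\bigoplus_{l\ge j}\mathfrak g_l$. Assume that the Killing form of $\tilde{\mathfrak g}$ restricts on $\mathfrak g$ to a non-zero multiple of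 the Killing form $B$ of $\mathfrak g$. Codifferential. Let $X_1,\dots,X_n\in\mathfrak g$ induce a basis of $\mathfrak g/\mathfrak p$ and let $Z_1,\dots,Z_n$ be the dual basis of $(\mathfrak g/\mathfrak p)^*\cong\mathfrak p^\perp=\mathfrak p_+$ (identification by the Killing form). For $\varphi\in\Lambda^2(\mathfrak g/\mathfrak p)^*\otimes\mathfrak g$ and $X\in\mathfrak g$ put $$\partial^*_1\varphi(X)=2\sum_{a=1}^n[\varphi(X_a,X),Z_a],\qquad \partial^*_2\varphi(X)=\sum_{a=1}^n\varphi(X_a,[Z_a,X]),\qquad \partial^*=\partial^*_1+\partial^*_2 ,$$ and define $\tilde\partial^*$ in the same way for $(\tilde{\mathfrak g},\tilde{\mathfrak p})$. Geometry. Let $(\mathcal G\to M,\omega)$ be a parabolic geometry of type $(G,P)$: a smooth principal $P$-bundle with a Cartan connection $\omega\in\Omega^1(\mathcal G,\mathfrak g)$. Its curvature is $K(\xi,\eta)=d\omega(\xi,\eta)+[\omega(\xi),\omega(\eta)]$, and its curvature function is $\kappa(u)(X+\mathfrak p,Y+\mathfrak p)=K(\omega(u)^{-1}X,\omega(u)^{-1}Y)$.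 It is regular if $\kappa(u)(\mathfrak g^i,\mathfrak g^j)\subset\mathfrak g^{i+j+1}$ for all $u$ and all $i,j<0$, and normal if $\partial^*\kappa(u)=0$ for all $u\in\mathcal G$. The induced conformal parabolic geometry of type $(\tilde G,\tilde P)$ is $(\tilde{\mathcal G}\to\tilde M,\tilde\omega)$, where $\tilde M=\mathcal G/Q$, $\tilde{\mathcal G}=\mathcal G\times_Q\tilde P$, and $\tilde\omega$ is the Cartan connection on $\tilde{\mathcal G}$ whose pullback along $\mathcal G\to\tilde{\mathcal G}$ is $\omega$ (viewed as $\tilde{\mathfrak g}$-valued); $\tilde\kappa$ is its curvature function. Proposition. Suppose that $(\mathcal G\to M,\omega)$ is regular and normal, that $\kappa$ takes values in $\Lambda^2(\mathfrak g/\mathfrak p)^*\otimes(\mathfrak g\cap\tilde{\mathfrak p})$, and that the two summands of the normality condition vanish separately: $\partial^*_1\kappa=0$ and $\partial^*_2\kappa=0$. Then $\tilde\partial^*\tilde\kappa=0$, i.e. the induced conformal parabolic geometry $(\tilde{\mathcal G}\to\tilde M,\tilde\omega)$ is normal. -/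

import Mathlib

open scoped Manifold ContDiff

noncomputable section

namespace Fefferman

/-! ## Lie algebras: gradings and the Kostant codifferential -/

section Algebra

variable {L : Type*} [LieRing L] [LieAlgebra ℝ L]

/-- `gr` is a `|k|`-grading (for some `k`) of the Lie algebra `L`:
`L = ⨁ i, gr i` with `[gr i, gr j] ⊆ gr (i + j)`, only finitely many components are non-zero
(symmetrically, `-k ≤ i ≤ k`), and the negative part is generated by `gr (-1)`.
For semisimple `L` the parabolic subalgebras are exactly the non-negative parts of such
gradings. -/
structure IsParabolicGrading (gr : ℤ → Submodule ℝ L) : Prop where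
  isInternal : DirectSum.IsInternal gr
  lie_mem : ∀ i j x y, x ∈ gr i → y ∈ gr j → ⁅x, y⁆ ∈ gr (i + j)
  bounded : ∃ k : ℕ, ∀ i : ℤ, (k : ℤ) < |i| → gr i = ⊥
  generated : ∀ i < 0, ∀ x ∈ gr i, x ∈ LieSubalgebra.lieSpan ℝ L (gr (-1) : Set L)

/-- The filtration `L^i = ⨁ j ≥ i, gr j`; the parabolic subalgebra is `L^0`. -/
def filt (gr : ℤ → Submodule ℝ L) (i : ℤ) : Submodule ℝ L := ⨆ j ≥ i, gr j

variable [FiniteDimensional ℝ L] (p : Submodule ℝ L)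

/-- Elements `X₁, …, Xₙ` of `L` inducing a basis of `L / p`. -/
def frame (a : Fin (Module.finrank ℝ (L ⧸ p))) : L :=
  Function.surjInv p.mkQ_surjective (Module.finBasis ℝ (L ⧸ p) a)

/-- The dual basis `Z₁, …, Zₙ` of `(L / p)^* ≅ p^⊥ = p₊ ⊆ L`. The identification uses the Killing
form: `Z_a` is the element with `B (Z_a, Y) = (dual basis vector) (Y + p)` for all `Y` in `L`
(it exists and is unique when the Killing form is non-degenerate). -/
def coframe (a : Fin (Module.finrank ℝ (L ⧸ p))) : L :=
  Function.invFun (fun Z : L => (killingForm ℝ L Z : Module.Dual ℝ L))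
    (((Module.finBasis ℝ (L ⧸ p)).coord a).comp p.mkQ)

/-- First summand of the Kostant codifferential on 2-cochains
`φ ∈ Λ²(L/p)^* ⊗ L` (given as a function on `L × L`): `2 ∑ₐ [φ(Xₐ, X), Zₐ]`. -/
def codiffOne (φ : L → L → L) (X : L) : L :=
  (2 : ℝ) • ∑ a, ⁅φ (frame p a) X, coframe p a⁆

/-- Second summand of the Kostant codifferential on 2-cochains: `∑ₐ φ(Xₐ, [Zₐ, X])`. -/
def codiffTwo (φ : L → L → L) (X : L) : L :=
  ∑ a, φ (frame p a) ⁅coframe p a, X⁆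

/-- The Kostant codifferential on 2-cochains. -/
def codiff (φ : L → L → L) (X : L) : L := codiffOne p φ X + codiffTwo p φ X

end Algebra

/-! ## Vector-valued one-forms on manifolds -/

section Forms

variable {E F X : Type*} [NormedAddCommGroup E] [NormedSpace ℝ E]
  [NormedAddCommGroup F] [NormedSpace ℝ F] [TopologicalSpace X] [ChartedSpace E X]

/-- The expression of the `F`-valued one-form `θ` in the chart at `x₀`
(the pullback of `θ` along the inverse of the chart). -/
def localForm (θ : ∀ x : X, TangentSpace 𝓘(ℝ, E) x →L[ℝ] F) (x₀ : X) (y : E) : E →L[ℝ] F :=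
  (θ ((extChartAt 𝓘(ℝ, E) x₀).symm y)).comp
    (mfderiv 𝓘(ℝ, E) 𝓘(ℝ, E) (extChartAt 𝓘(ℝ, E) x₀).symm y)

/-- The one-form `θ` is smooth: it is so in all charts. -/
def IsSmoothForm (θ : ∀ x : X, TangentSpace 𝓘(ℝ, E) x →L[ℝ] F) : Prop :=
  ∀ x₀ : X, ContDiffOn ℝ ∞ (localForm θ x₀) (extChartAt 𝓘(ℝ, E) x₀).target

/-- The exterior derivative `dθ(ξ, η)` at `x`, computed in the chart at `x` by
`dθ(ξ, η) = (D_ξ θ)(η) - (D_η θ)(ξ)`. -/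
def extDer (θ : ∀ x : X, TangentSpace 𝓘(ℝ, E) x →L[ℝ] F) (x : X)
    (ξ η : TangentSpace 𝓘(ℝ, E) x) : F :=
  let D := fderiv ℝ (localForm θ x) (extChartAt 𝓘(ℝ, E) x x)
  let ξ' : E := mfderiv 𝓘(ℝ, E) 𝓘(ℝ, E) (extChartAt 𝓘(ℝ, E) x) x ξ
  let η' : E := mfderiv 𝓘(ℝ, E) 𝓘(ℝ, E) (extChartAt 𝓘(ℝ, E) x) x η
  D ξ' η' - D η' ξ'

end Forms

/-! ## Lie groups and closed subgroups -/

section Groups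

variable {E G : Type*} [NormedAddCommGroup E] [NormedSpace ℝ E]
  [TopologicalSpace G] [ChartedSpace E G] [Group G]

instance instLieGroupMinSmoothness [LieGroup 𝓘(ℝ, E) ∞ G] :
    LieGroup 𝓘(ℝ, E) (minSmoothness ℝ 3) G :=
  LieGroup.of_le (n := ∞) (by
    rw [minSmoothness_of_isRCLikeNormedField]; exact ENat.LEInfty.out)

instance (priority := low) instCompleteSpaceOfFiniteDimensional (V : Type*)
    [NormedAddCommGroup V] [NormedSpace ℝ V] [FiniteDimensional ℝ V] : CompleteSpace V :=
  FiniteDimensional.complete ℝ V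

instance instFiniteDimensionalGroupLieAlgebra [FiniteDimensional ℝ E] :
    FiniteDimensional ℝ (GroupLieAlgebra 𝓘(ℝ, E) G) :=
  inferInstanceAs (FiniteDimensional ℝ E)

/-- The adjoint action `Ad(g)`, the derivative at `1` of `x ↦ g x g⁻¹`. -/
def Ad (g : G) : GroupLieAlgebra 𝓘(ℝ, E) G →L[ℝ] GroupLieAlgebra 𝓘(ℝ, E) G :=
  (mfderiv 𝓘(ℝ, E) 𝓘(ℝ, E) (fun x : G => g * x * g⁻¹) 1 : E →L[ℝ] E)

variable {EH : Type*} [NormedAddCommGroup EH] [NormedSpace ℝ EH]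

/-- The derivative at `1` of the inclusion of a subgroup `H` of `G`. -/
def subgroupDeriv (H : Subgroup G) [ChartedSpace EH H] :
    GroupLieAlgebra 𝓘(ℝ, EH) H →L[ℝ] GroupLieAlgebra 𝓘(ℝ, E) G :=
  (mfderiv 𝓘(ℝ, EH) 𝓘(ℝ, E) (Subtype.val : H → G) 1 : EH →L[ℝ] E)

/-- The Lie algebra of a subgroup `H`, as a subspace of the Lie algebra of `G`. -/
def subgroupLieAlgebra (E : Type*) [NormedAddCommGroup E] [NormedSpace ℝ E] [ChartedSpace E G]
    (EH : Type*) [NormedAddCommGroup EH] [NormedSpace ℝ EH]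
    (H : Subgroup G) [ChartedSpace EH H] : Submodule ℝ (GroupLieAlgebra 𝓘(ℝ, E) G) :=
  (subgroupDeriv (E := E) (EH := EH) H).range

/-- `H` is a closed subgroup of the Lie group `G`, and its manifold structure is the one of an
embedded submanifold of `G` (the topology of `H` being the subspace topology). -/
structure IsClosedLieSubgroup (E : Type*) [NormedAddCommGroup E] [NormedSpace ℝ E]
    [ChartedSpace E G] (EH : Type*) [NormedAddCommGroup EH] [NormedSpace ℝ EH]
    (H : Subgroup G) [ChartedSpace EH H] : Prop where
  isClosed : IsClosed (H : Set G)
  contMDiff : ContMDiff 𝓘(ℝ, EH) 𝓘(ℝ, E) ∞ (Subtype.val : H → G)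
  injective : ∀ h : H,
    Function.Injective (mfderiv 𝓘(ℝ, EH) 𝓘(ℝ, E) (Subtype.val : H → G) h)

variable {Et Gt : Type*} [NormedAddCommGroup Et] [NormedSpace ℝ Et]
  [TopologicalSpace Gt] [ChartedSpace Et Gt] [Group Gt]

/-- `i` is an inclusion of Lie groups: an injective immersive smooth homomorphism. -/
structure IsLieGroupInclusion (E : Type*) [NormedAddCommGroup E] [NormedSpace ℝ E]
    [ChartedSpace E G] (Et : Type*) [NormedAddCommGroup Et] [NormedSpace ℝ Et]
    [ChartedSpace Et Gt] (i : G →* Gt) : Prop where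
  injective : Function.Injective i
  contMDiff : ContMDiff 𝓘(ℝ, E) 𝓘(ℝ, Et) ∞ i
  injective_mfderiv : ∀ g : G, Function.Injective (mfderiv 𝓘(ℝ, E) 𝓘(ℝ, Et) i g)

/-- The derivative `i' : 𝔤 → 𝔤̃` of a homomorphism of Lie groups. -/
def homDeriv (E : Type*) [NormedAddCommGroup E] [NormedSpace ℝ E] [ChartedSpace E G]
    (Et : Type*) [NormedAddCommGroup Et] [NormedSpace ℝ Et] [ChartedSpace Et Gt] (i : G →* Gt) :
    GroupLieAlgebra 𝓘(ℝ, E) G →L[ℝ] GroupLieAlgebra 𝓘(ℝ, Et) Gt :=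
  (mfderiv 𝓘(ℝ, E) 𝓘(ℝ, Et) i 1 : E →L[ℝ] Et)

end Groups

/-! ## Principal bundles, Cartan connections and their curvature -/

/-- A smooth principal bundle `proj : X → M` with structure group `H`: a smooth right action of
`H` on `X` for which `X` is locally, over `M`, equivariantly diffeomorphic to `U × H`
(the diffeomorphism is `(y, h) ↦ s(y) · h`, with inverse `u ↦ (proj u, τ u)`). -/
structure PrincipalBundle (EH H EM M EX X : Type*)
    [NormedAddCommGroup EH] [NormedSpace ℝ EH] [TopologicalSpace H] [ChartedSpace EH H] [Group H]
    [NormedAddCommGroup EM] [NormedSpace ℝ EM] [TopologicalSpace M] [ChartedSpace EM M]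
    [NormedAddCommGroup EX] [NormedSpace ℝ EX] [TopologicalSpace X] [ChartedSpace EX X] where
  proj : X → M
  act : X → H → X
  act_one : ∀ u, act u 1 = u
  act_mul : ∀ u h k, act u (h * k) = act (act u h) k
  proj_act : ∀ u h, proj (act u h) = proj u
  contMDiff_proj : ContMDiff 𝓘(ℝ, EX) 𝓘(ℝ, EM) ∞ proj
  contMDiff_act : ContMDiff (𝓘(ℝ, EX).prod 𝓘(ℝ, EH)) 𝓘(ℝ, EX) ∞ (fun z : X × H => act z.1 z.2)
  locally_trivial : ∀ x : M, ∃ U : Set M, IsOpen U ∧ x ∈ U ∧ ∃ (s : M → X) (τ : X → H),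
    ContMDiffOn 𝓘(ℝ, EM) 𝓘(ℝ, EX) ∞ s U ∧
    ContMDiffOn 𝓘(ℝ, EX) 𝓘(ℝ, EH) ∞ τ (proj ⁻¹' U) ∧
    (∀ y ∈ U, proj (s y) = y) ∧
    (∀ u, proj u ∈ U → act (s (proj u)) (τ u) = u) ∧
    (∀ y ∈ U, ∀ h, τ (act (s y) h) = h)

section Cartan

variable {E G : Type*} [NormedAddCommGroup E] [NormedSpace ℝ E]
  [TopologicalSpace G] [ChartedSpace E G] [Group G]
  {EH : Type*} [NormedAddCommGroup EH] [NormedSpace ℝ EH] {H : Subgroup G} [ChartedSpace EH H]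
  {EM M : Type*} [NormedAddCommGroup EM] [NormedSpace ℝ EM] [TopologicalSpace M]
  [ChartedSpace EM M]
  {EX X : Type*} [NormedAddCommGroup EX] [NormedSpace ℝ EX] [TopologicalSpace X]
  [ChartedSpace EX X]

/-- A Cartan connection of type `(G, H)` on the principal `H`-bundle `B`. -/
structure CartanConnection (E : Type*) [NormedAddCommGroup E] [NormedSpace ℝ E]
    [ChartedSpace E G] (B : PrincipalBundle EH H EM M EX X) where
  /-- the underlying one-form with values in the Lie algebra of `G` -/
  form : ∀ u : X, TangentSpace 𝓘(ℝ, EX) u →L[ℝ] GroupLieAlgebra 𝓘(ℝ, E) G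
  smooth : IsSmoothForm (F := E) form
  /-- `(R_h)^* θ = Ad(h⁻¹) ∘ θ` -/
  equivariant : ∀ (h : H) (u : X) (ξ : TangentSpace 𝓘(ℝ, EX) u),
    form (B.act u h) (mfderiv 𝓘(ℝ, EX) 𝓘(ℝ, EX) (fun v => B.act v h) u ξ)
      = Ad (h : G)⁻¹ (form u ξ)
  /-- `θ` reproduces the generators of fundamental vector fields -/
  fundamental : ∀ (u : X) (A : GroupLieAlgebra 𝓘(ℝ, EH) H),
    form (B.act u 1) (mfderiv 𝓘(ℝ, EH) 𝓘(ℝ, EX) (fun h => B.act u h) 1 A)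
      = subgroupDeriv H A
  bijective : ∀ u, Function.Bijective (form u)

namespace CartanConnection

variable {B : PrincipalBundle EH H EM M EX X} (θ : CartanConnection E B)

/-- The inverse `θ(u)⁻¹ : 𝔤 → T_u X`. -/
def inv (u : X) : GroupLieAlgebra 𝓘(ℝ, E) G → TangentSpace 𝓘(ℝ, EX) u :=
  (Equiv.ofBijective (θ.form u) (θ.bijective u)).symm

/-- The curvature two-form `K(ξ, η) = dθ(ξ, η) + [θ(ξ), θ(η)]`. -/
def curvature (u : X) (ξ η : TangentSpace 𝓘(ℝ, EX) u) : GroupLieAlgebra 𝓘(ℝ, E) G :=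
  let dθ : GroupLieAlgebra 𝓘(ℝ, E) G := extDer (F := E) θ.form u ξ η
  dθ + ⁅θ.form u ξ, θ.form u η⁆

/-- The curvature function `κ(u)(X + 𝔥, Y + 𝔥) = K(θ⁻¹(u)(X), θ⁻¹(u)(Y))`. -/
def curvatureFunction (u : X) (x y : GroupLieAlgebra 𝓘(ℝ, E) G) : GroupLieAlgebra 𝓘(ℝ, E) G :=
  θ.curvature u (θ.inv u x) (θ.inv u y)

/-- Regularity with respect to the grading `gr`: the curvature has positive homogeneity, i.e.
`κ(u)(𝔤^i, 𝔤^j) ⊆ 𝔤^(i+j+1)` for all `i, j < 0`. -/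
def IsRegular [LieGroup 𝓘(ℝ, E) ∞ G] [FiniteDimensional ℝ E]
    (gr : ℤ → Submodule ℝ (GroupLieAlgebra 𝓘(ℝ, E) G)) : Prop :=
  ∀ (u : X) (i j : ℤ), i < 0 → j < 0 → ∀ x ∈ filt gr i, ∀ y ∈ filt gr j,
    θ.curvatureFunction u x y ∈ filt gr (i + j + 1)

/-- Normality: the Kostant codifferential of the curvature function vanishes. -/
def IsNormal [LieGroup 𝓘(ℝ, E) ∞ G] [FiniteDimensional ℝ E] : Prop :=
  ∀ (u : X) (x : GroupLieAlgebra 𝓘(ℝ, E) G),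
    codiff (subgroupLieAlgebra E EH H) (θ.curvatureFunction u) x = 0

end CartanConnection

end Cartan

/-! ## The Fefferman-type construction -/

section Construction

/-- The Lie algebra `𝔤̃` is identified by `φ` with `𝔰𝔬(p+1, q+1)`, and the closed subgroup `Pt` is
the conformal parabolic belonging to the null line spanned by the non-zero null vector `v`: its
Lie algebra is the stabiliser of that line. (This includes the stabiliser of the line in `Gt`
as well as the stabiliser of a ray in it.) -/
structure IsConformalParabolic {Et Gt EPt : Type*} [NormedAddCommGroup Et] [NormedSpace ℝ Et]
    [FiniteDimensional ℝ Et] [TopologicalSpace Gt] [ChartedSpace Et Gt] [Group Gt]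
    [LieGroup 𝓘(ℝ, Et) ∞ Gt] [NormedAddCommGroup EPt] [NormedSpace ℝ EPt] (Pt : Subgroup Gt) [ChartedSpace EPt Pt]
    (p q : ℕ)
    (φ : GroupLieAlgebra 𝓘(ℝ, Et) Gt ≃ₗ⁅ℝ⁆
      LieAlgebra.Orthogonal.so' (Fin (p + 1)) (Fin (q + 1)) ℝ)
    (v : Fin (p + 1) ⊕ Fin (q + 1) → ℝ) : Prop where
  closed : IsClosedLieSubgroup Et EPt Pt
  ne_zero : v ≠ 0
  null : v ⬝ᵥ Matrix.mulVec
    (LieAlgebra.Orthogonal.indefiniteDiagonal (Fin (p + 1)) (Fin (q + 1)) ℝ) v = 0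
  mem_iff : ∀ x : GroupLieAlgebra 𝓘(ℝ, Et) Gt, x ∈ subgroupLieAlgebra Et EPt Pt ↔
    ∃ c : ℝ, Matrix.mulVec (φ x : Matrix _ _ ℝ) v = c • v

variable {E G : Type*} [NormedAddCommGroup E] [NormedSpace ℝ E]
  [TopologicalSpace G] [ChartedSpace E G] [Group G]
  {Et Gt : Type*} [NormedAddCommGroup Et] [NormedSpace ℝ Et]
  [TopologicalSpace Gt] [ChartedSpace Et Gt] [Group Gt]
  {EP : Type*} [NormedAddCommGroup EP] [NormedSpace ℝ EP] {P : Subgroup G} [ChartedSpace EP P]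
  {EPt : Type*} [NormedAddCommGroup EPt] [NormedSpace ℝ EPt] {Pt : Subgroup Gt}
  [ChartedSpace EPt Pt]
  {EM M : Type*} [NormedAddCommGroup EM] [NormedSpace ℝ EM] [TopologicalSpace M]
  [ChartedSpace EM M]
  {EX X : Type*} [NormedAddCommGroup EX] [NormedSpace ℝ EX] [TopologicalSpace X]
  [ChartedSpace EX X]

/-- The Cartan geometry of type `(Gt, Pt)` obtained from the Cartan geometry `(B, θ)` of type
`(G, P)` along `i : G → Gt`, where `Q = i⁻¹(Pt) ⊆ P`. It consists of

* `Mt = X / Q`: the principal `Q`-bundle `X → Mt` for the restriction of the `P`-action;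
* `Xt = X ×_Q Pt`: the quotient manifold of `X × Pt` by the `Q`-action
  `(u, p) · q = (u · q, i(q)⁻¹ p)`, with quotient map `quot`, as a principal `Pt`-bundle over `Mt`
  via `quot(u, p) · p' = quot(u, p p')` and `quot(u, p) ↦ [u]`;
* the Cartan connection on `Xt` that restricts to `θ` along `u ↦ quot(u, 1)`.

These conditions determine all the data up to unique isomorphism. -/
structure FeffermanSpace (i : G →* Gt) (hQP : Pt.comap i ≤ P)
    (EQ : Type*) [NormedAddCommGroup EQ] [NormedSpace ℝ EQ] [ChartedSpace EQ (Pt.comap i)]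
    {B : PrincipalBundle EP P EM M EX X} (θ : CartanConnection E B)
    (Et : Type*) [NormedAddCommGroup Et] [NormedSpace ℝ Et] [ChartedSpace Et Gt]
    (EMt Mt : Type*) [NormedAddCommGroup EMt] [NormedSpace ℝ EMt] [TopologicalSpace Mt]
    [ChartedSpace EMt Mt]
    (EXt Xt : Type*) [NormedAddCommGroup EXt] [NormedSpace ℝ EXt] [TopologicalSpace Xt]
    [ChartedSpace EXt Xt] where
  /-- the principal `Q`-bundle `X → Mt` -/
  corr : PrincipalBundle EQ (Pt.comap i) EMt Mt EX X
  corr_act : ∀ (u : X) (q : Pt.comap i), corr.act u q = B.act u ⟨q, hQP q.2⟩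
  /-- the principal `Pt`-bundle `Xt → Mt` -/
  bundle : PrincipalBundle EPt Pt EMt Mt EXt Xt
  /-- the quotient map `X × Pt → Xt` -/
  quot : X × Pt → Xt
  contMDiff_quot : ContMDiff (𝓘(ℝ, EX).prod 𝓘(ℝ, EPt)) 𝓘(ℝ, EXt) ∞ quot
  surjective_quot : Function.Surjective quot
  surjective_mfderiv_quot : ∀ z : X × Pt,
    Function.Surjective (mfderiv (𝓘(ℝ, EX).prod 𝓘(ℝ, EPt)) 𝓘(ℝ, EXt) quot z)
  quot_eq_quot_iff : ∀ (u u' : X) (p p' : Pt), quot (u, p) = quot (u', p') ↔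
    ∃ q : Pt.comap i, u' = corr.act u q ∧ p' = (⟨i q, q.2⟩ : Pt)⁻¹ * p
  act_quot : ∀ (u : X) (p p' : Pt), bundle.act (quot (u, p)) p' = quot (u, p * p')
  proj_quot : ∀ (u : X) (p : Pt), bundle.proj (quot (u, p)) = corr.proj u
  /-- the induced Cartan connection -/
  conn : CartanConnection Et bundle
  conn_restrict : ∀ (u : X) (ξ : TangentSpace 𝓘(ℝ, EX) u),
    conn.form (quot (u, 1)) (mfderiv 𝓘(ℝ, EX) 𝓘(ℝ, EXt) (fun w => quot (w, 1)) u ξ)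
      = homDeriv E Et i (θ.form u ξ)

end Construction

end Fefferman

end

/-!
The proof of `mainTheorem5` rests on a description of the codifferential that involves neither a
frame nor the identification `(𝔤/𝔭)^* ≅ 𝔭₊`. If `φ` kills `𝔭`, then `∂₁^* φ` is determined by
`B(∂₁^* φ(x), y) = -2 tr (z ↦ ⁅φ(z, x), y⁆)`, where `B` is the Killing form of `𝔤`
(`killingForm_codiffOne`). The trace is taken over all of `𝔤`, which makes it easy to compare `𝔤`
with `𝔤̃`: if `φ'` on `𝔤̃ = 𝔤 + 𝔭̃` restricts to `φ` on `𝔤` and kills `𝔭̃`, the corresponding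
endomorphism of `𝔤̃` takes values in `𝔤` and extends that of `𝔤`, so that the two traces agree.

For the induced conformal geometry this shows that `∂̃₁^* κ̃` is orthogonal to `𝔤` as soon as
`∂₁^* κ = 0`. It is also orthogonal to `𝔭̃`, because `κ` takes values in `𝔭̃`; hence it vanishes. The
second summand `∂̃₂^* κ̃` vanishes for a different reason: the conformal grading of `𝔤̃` has length
one, so that `⁅𝔭̃^⊥, 𝔤̃⁆ ⊆ 𝔭̃`, and `κ̃` is horizontal. This is `codiff_eq_zero_of_restrict`. It needs
the Killing forms to be non-degenerate. For `𝔤` this is Cartan's criterion; for `𝔰𝔬(p+1, q+1)` the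
Killing form is a multiple of the trace form (`killingForm_skewAdjoint`), and it is non-degenerate
except in signature `(1, 1)`, where `𝔭̃ = 𝔤̃` and there is nothing to prove.

The geometric input consists of three facts.

* Curvature is horizontal (`CartanConnection.curvatureFunction_eq_zero_right`).
* At the point `quot(u, h)`, the curvature `κ̃` restricts to `κ(u)` along the derivative `ρ` of the
  homomorphism `g ↦ h⁻¹ i(g) h` (`curvatureFunction_quot`). Using this homomorphism in place of `i`
  treats all points of the induced bundle alike, so that no equivariance of `κ̃` is needed.
* `𝔤̃ = ρ(𝔤) + 𝔭̃`, because `X × Pt → Xt` is a submersion (`exists_eq_homDeriv_add`).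

Both statements on curvature come from computing exterior derivatives after pulling back to a
vector space (`extDer_pullback`). Applied to the Maurer–Cartan form, the same computations show that
the derivative of a homomorphism of Lie groups preserves brackets (`homDeriv_lie`) and that the
derivative of `Ad` is given by the bracket (`fderiv_Ad_inv`).
-/

noncomputable section

namespace Fefferman

/-! ### The codifferential as a trace -/

section Codifferential

variable {L : Type*} [LieRing L] [LieAlgebra ℝ L]

lemma killingForm_lie_left (x y z : L) :
    killingForm ℝ L ⁅x, y⁆ z = -killingForm ℝ L y ⁅x, z⁆ :=
  LieModule.traceForm_apply_lie_apply' ℝ L L x y z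

variable [FiniteDimensional ℝ L]

lemma killingForm_coframe [LieAlgebra.IsKilling ℝ L] (p : Submodule ℝ L)
    (a : Fin (Module.finrank ℝ (L ⧸ p))) (y : L) :
    killingForm ℝ L (coframe p a) y = (Module.finBasis ℝ (L ⧸ p)).coord a (p.mkQ y) := by
  have hsurj : Function.Surjective (killingForm ℝ L) :=
    (LinearMap.injective_iff_surjective_of_finrank_eq_finrank
      (Subspace.dual_finrank_eq (K := ℝ) (V := L)).symm).1
      (LinearMap.ker_eq_bot.1 (LieAlgebra.IsKilling.ker_killingForm_eq_bot ℝ L))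
  have h := Function.invFun_eq
    (f := fun Z : L => (killingForm ℝ L Z : Module.Dual ℝ L))
    (hsurj (((Module.finBasis ℝ (L ⧸ p)).coord a).comp p.mkQ))
  exact LinearMap.congr_fun h y

lemma mkQ_frame (p : Submodule ℝ L) (a : Fin (Module.finrank ℝ (L ⧸ p))) :
    p.mkQ (frame p a) = Module.finBasis ℝ (L ⧸ p) a :=
  Function.surjInv_eq p.mkQ_surjective _

/-- An endomorphism that kills `p` factors through `L ⧸ p`, and its trace can be computed there. -/
lemma sum_coord_frame_eq_trace (p : Submodule ℝ L) (T : L →ₗ[ℝ] L) (hT : ∀ x ∈ p, T x = 0) :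
    ∑ a, (Module.finBasis ℝ (L ⧸ p)).coord a (p.mkQ (T (frame p a)))
      = LinearMap.trace ℝ L T := by
  have hT' : p ≤ LinearMap.ker T := hT
  have hfac : T = (p.liftQ T hT').comp p.mkQ := (p.liftQ_mkQ T hT').symm
  conv_rhs => rw [hfac, LinearMap.trace_comp_comm',
    LinearMap.trace_eq_matrix_trace ℝ (Module.finBasis ℝ (L ⧸ p))]
  refine Finset.sum_congr rfl fun a _ => ?_
  rw [Matrix.diag_apply, LinearMap.toMatrix_apply]
  conv_rhs => rw [← mkQ_frame p a]
  rfl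

/-- Against the Killing form, `∂₁^*` is the trace of `z ↦ ⁅φ(z, x), y⁆`; in particular it does not
involve the chosen frame. -/
lemma killingForm_codiffOne [LieAlgebra.IsKilling ℝ L] (p : Submodule ℝ L)
    (φ : L →ₗ[ℝ] L →ₗ[ℝ] L) (hφ : ∀ x ∈ p, ∀ y, φ x y = 0) (x y : L) :
    killingForm ℝ L (codiffOne p (fun a b => φ a b) x) y
      = -2 * LinearMap.trace ℝ L ((-LieAlgebra.ad ℝ L y) ∘ₗ φ.flip x) := by
  rw [← sum_coord_frame_eq_trace p _ (fun z hz => by simp [hφ z hz])]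
  simp only [codiffOne, map_smul, map_sum, LinearMap.smul_apply, LinearMap.sum_apply,
    killingForm_lie_left, killingForm_coframe, smul_eq_mul, Finset.sum_neg_distrib]
  rw [mul_neg, neg_mul]
  congr 3
  ext a
  simp

end Codifferential

section Comparison

variable {L L' : Type*} [LieRing L] [LieAlgebra ℝ L] [FiniteDimensional ℝ L]
  [LieRing L'] [LieAlgebra ℝ L'] [FiniteDimensional ℝ L']

/-- If `ρ` is injective, `T' ∘ ρ = ρ ∘ T`, and `T'` takes values in the range of `ρ`, then `T` and
`T'` have the same trace. -/
lemma trace_eq_trace_of_intertwining (ρ : L →ₗ[ℝ] L') (hρ : Function.Injective ρ)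
    (T : L →ₗ[ℝ] L) (T' : L' →ₗ[ℝ] L') (hT : ∀ x, T' (ρ x) = ρ (T x))
    (hT' : ∀ z, T' z ∈ LinearMap.range ρ) :
    LinearMap.trace ℝ L' T' = LinearMap.trace ℝ L T := by
  obtain ⟨σ, hσ⟩ := LinearMap.exists_leftInverse_of_injective ρ (LinearMap.ker_eq_bot.2 hρ)
  have hσ' : ∀ x, σ (ρ x) = x := fun x => LinearMap.congr_fun hσ x
  have h1 : T' = ρ ∘ₗ (σ ∘ₗ T') := by
    ext z
    obtain ⟨x, hx⟩ := hT' z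
    simp [← hx, hσ']
  have h2 : (σ ∘ₗ T') ∘ₗ ρ = T := by
    ext x
    simp [hT, hσ']
  rw [h1, LinearMap.trace_comp_comm', h2]

/-- The purely algebraic content of the comparison of normality conditions: if the 2-cochain `φ'`
on `L'` restricts to `φ` along `ρ : L → L'`, with `L' = ρ(L) + p'`, then `∂₁^* φ = 0` implies
`∂^* φ' = 0`, provided that `φ` takes values in `ρ⁻¹(p')` and `⁅p'^⊥, L'⁆ ⊆ p'`. -/
lemma codiff_eq_zero_of_restrict [LieAlgebra.IsKilling ℝ L] [LieAlgebra.IsKilling ℝ L']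
    (p : Submodule ℝ L) (p' : Submodule ℝ L') (ρ : L →ₗ⁅ℝ⁆ L') (hρ : Function.Injective ρ)
    (hsup : ∀ z, ∃ x, ∃ y ∈ p', z = ρ x + y)
    (hlie : ∀ x ∈ p', ∀ y ∈ p', ⁅x, y⁆ ∈ p')
    (hperp : ∀ z, (∀ y ∈ p', killingForm ℝ L' z y = 0) → ∀ x, ⁅z, x⁆ ∈ p')
    (φ : L →ₗ[ℝ] L →ₗ[ℝ] L) (φ' : L' →ₗ[ℝ] L' →ₗ[ℝ] L')
    (hφ : ∀ x ∈ p, ∀ y, φ x y = 0) (hφ' : ∀ x ∈ p', ∀ y, φ' x y = 0)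
    (halt : ∀ x y, φ' x y = -φ' y x)
    (hres : ∀ x y, φ' (ρ x) (ρ y) = ρ (φ x y)) (hval : ∀ x y, ρ (φ x y) ∈ p')
    (hone : ∀ x, codiffOne p (fun a b => φ a b) x = 0) (x' : L') :
    codiff p' (fun a b => φ' a b) x' = 0 := by
  have hφ'r : ∀ x, ∀ y ∈ p', φ' x y = 0 := fun x y hy => by rw [halt, hφ' y hy, neg_zero]
  have hval' : ∀ x y, φ' x y ∈ LinearMap.range (ρ : L →ₗ[ℝ] L') ⊓ p' := by
    intro x y
    obtain ⟨x, u, hu, rfl⟩ := hsup x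
    obtain ⟨y, w, hw, rfl⟩ := hsup y
    have : φ' (ρ x + u) (ρ y + w) = ρ (φ x y) := by
      simp [hφ' u hu, hφ'r _ w hw, hres]
    rw [this]
    exact ⟨⟨_, rfl⟩, hval x y⟩
  have hco : ∀ a, ∀ y ∈ p', killingForm ℝ L' (coframe p' a) y = 0 := by
    intro a y hy
    rw [killingForm_coframe, Submodule.mkQ_apply, (Submodule.Quotient.mk_eq_zero p').2 hy, map_zero]
  have htwo : codiffTwo p' (fun a b => φ' a b) x' = 0 :=
    Finset.sum_eq_zero fun a _ => hφ'r _ _ (hperp _ (hco a) x')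
  rw [codiff, htwo, add_zero]
  have hker : ∀ z, (∀ y, killingForm ℝ L' z y = 0) → z = 0 := fun z hz =>
    (LieAlgebra.IsKilling.killingForm_nondegenerate ℝ L').1 z hz
  refine hker _ fun y' => ?_
  obtain ⟨x, u, hu, rfl⟩ := hsup x'
  obtain ⟨y, w, hw, rfl⟩ := hsup y'
  rw [map_add]
  -- The value lies in `p'^⊥`, so that only the directions in the range of `ρ` have to be tested.
  have h1 : killingForm ℝ L' (codiffOne p' (fun a b => φ' a b) (ρ x + u)) w = 0 := by
    simp only [codiffOne, map_smul, map_sum, LinearMap.smul_apply, LinearMap.sum_apply]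
    rw [Finset.sum_eq_zero, smul_zero]
    intro a _
    rw [killingForm_lie_left, hco a _ (hlie _ (hval' _ _).2 _ hw), neg_zero]
  have h2 := killingForm_codiffOne p φ hφ x y
  rw [hone, map_zero, LinearMap.zero_apply] at h2
  rw [h1, add_zero, killingForm_codiffOne p' φ' hφ', h2]
  congr 1
  refine trace_eq_trace_of_intertwining (ρ : L →ₗ[ℝ] L') hρ _ _ (fun z => ?_) (fun z => ?_)
  · simp [hφ'r _ u hu, hres]
  · obtain ⟨t, ht⟩ := (hval' z (ρ x + u)).1
    refine ⟨-⁅y, t⁆, ?_⟩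
    simp only [LieHom.coe_toLinearMap] at ht
    simp only [LinearMap.comp_apply, LinearMap.neg_apply, LinearMap.flip_apply, ← ht]
    simp

/-- If `p` is everything, the sums defining the codifferential are empty. -/
lemma codiff_top (φ : L → L → L) (x : L) : codiff (⊤ : Submodule ℝ L) φ x = 0 := by
  have h0 : Module.finrank ℝ (L ⧸ (⊤ : Submodule ℝ L)) = 0 := Module.finrank_zero_of_subsingleton
  have : IsEmpty (Fin (Module.finrank ℝ (L ⧸ (⊤ : Submodule ℝ L)))) := by
    rw [h0]; infer_instance
  simp [codiff, codiffOne, codiffTwo]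

end Comparison

/-! ### The Killing form of `𝔰𝔬(p, q)` -/

section SkewAdjoint

open Matrix

lemma dotProduct_mulVec_comm {n : Type*} [Fintype n] {J : Matrix n n ℝ} (hJt : Jᵀ = J)
    (a b : n → ℝ) : a ⬝ᵥ J *ᵥ b = b ⬝ᵥ J *ᵥ a := by
  rw [dotProduct_mulVec, ← mulVec_transpose, hJt, dotProduct_comm]

attribute [local instance] LieRing.ofAssociativeRing

variable {n : Type*} [Fintype n] [DecidableEq n]

lemma trace_mulLeft_comp_mulRight (a b : Matrix n n ℝ) :
    LinearMap.trace ℝ (Matrix n n ℝ) (LinearMap.mulLeft ℝ a ∘ₗ LinearMap.mulRight ℝ b)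
      = a.trace * b.trace := by
  rw [LinearMap.trace_eq_matrix_trace ℝ (Matrix.stdBasis ℝ n n), Matrix.trace, Matrix.trace,
    Matrix.trace, Finset.sum_mul_sum, Fintype.sum_prod_type]
  refine Finset.sum_congr rfl fun i _ => Finset.sum_congr rfl fun j _ => ?_
  rw [Matrix.diag_apply, LinearMap.toMatrix_apply, Matrix.stdBasis_eq_single]
  change (a * (single i j (1 : ℝ) * b) : Matrix n n ℝ) i j = _
  simp [Matrix.mul_apply, Matrix.single_apply, ite_and]

lemma trace_mulLeft_comp_mulRight_comp_transpose (a b : Matrix n n ℝ) :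
    LinearMap.trace ℝ (Matrix n n ℝ) (LinearMap.mulLeft ℝ a ∘ₗ LinearMap.mulRight ℝ b ∘ₗ
        (Matrix.transposeLinearEquiv n n ℝ ℝ).toLinearMap)
      = (a * bᵀ).trace := by
  rw [LinearMap.trace_eq_matrix_trace ℝ (Matrix.stdBasis ℝ n n), Matrix.trace, Matrix.trace,
    Fintype.sum_prod_type]
  refine Finset.sum_congr rfl fun i _ => ?_
  rw [Matrix.diag_apply, Matrix.mul_apply]
  refine Finset.sum_congr rfl fun j _ => ?_
  rw [Matrix.diag_apply, LinearMap.toMatrix_apply, Matrix.stdBasis_eq_single]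
  change (a * ((single i j (1 : ℝ))ᵀ * b) : Matrix n n ℝ) i j = _
  simp [Matrix.mul_apply, Matrix.single_apply, ite_and]

variable {J : Matrix n n ℝ}

lemma mem_skewAdjointMatricesLieSubalgebra_iff (x : Matrix n n ℝ) :
    x ∈ skewAdjointMatricesLieSubalgebra J ↔ xᵀ * J = J * (-x) := by
  rw [mem_skewAdjointMatricesLieSubalgebra, mem_skewAdjointMatricesSubmodule,
    Matrix.IsSkewAdjoint, Matrix.IsAdjointPair]

/-- The projection of `𝔤𝔩(n)` onto the matrices that are skew-adjoint for `J`. -/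
def skewPart (hJt : Jᵀ = J) (hJJ : J * J = 1) :
    Matrix n n ℝ →ₗ[ℝ] skewAdjointMatricesLieSubalgebra J :=
  LinearMap.codRestrict (skewAdjointMatricesLieSubalgebra J).toSubmodule
    ((2⁻¹ : ℝ) • (LinearMap.id - LinearMap.mulLeft ℝ J ∘ₗ LinearMap.mulRight ℝ J ∘ₗ
      (Matrix.transposeLinearEquiv n n ℝ ℝ).toLinearMap)) fun z => by
    rw [LieSubalgebra.mem_toSubmodule, mem_skewAdjointMatricesLieSubalgebra_iff]
    change ((2⁻¹ : ℝ) • (z - J * (zᵀ * J)))ᵀ * J = J * (-((2⁻¹ : ℝ) • (z - J * (zᵀ * J))))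
    simp only [transpose_smul, transpose_sub, transpose_mul, transpose_transpose, hJt,
      smul_mul_assoc, mul_smul_comm, ← smul_neg, sub_mul, mul_sub, neg_sub]
    simp only [Matrix.mul_assoc, hJJ, Matrix.mul_one]
    rw [← Matrix.mul_assoc J J, hJJ, Matrix.one_mul]

lemma coe_skewPart (hJt : Jᵀ = J) (hJJ : J * J = 1) (z : Matrix n n ℝ) :
    (skewPart hJt hJJ z : Matrix n n ℝ) = (2⁻¹ : ℝ) • (z - J * (zᵀ * J)) := rfl

lemma transpose_mul_of_mem (x : skewAdjointMatricesLieSubalgebra J) :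
    (x : Matrix n n ℝ)ᵀ * J = -(J * x) := by
  have h : (x : Matrix n n ℝ)ᵀ * J = J * (-x) :=
    (mem_skewAdjointMatricesLieSubalgebra_iff _).1 x.2
  rw [h, mul_neg]

lemma transpose_eq_of_mem (hJJ : J * J = 1) (x : skewAdjointMatricesLieSubalgebra J) :
    (x : Matrix n n ℝ)ᵀ = -(J * x * J) := by
  rw [← neg_mul, ← transpose_mul_of_mem, Matrix.mul_assoc, hJJ, Matrix.mul_one]

lemma skewPart_coe (hJt : Jᵀ = J) (hJJ : J * J = 1) (x : skewAdjointMatricesLieSubalgebra J) :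
    skewPart hJt hJJ x = x := by
  ext1
  rw [coe_skewPart, transpose_mul_of_mem, mul_neg, ← Matrix.mul_assoc, hJJ, Matrix.one_mul,
    sub_neg_eq_add, ← two_smul ℝ, smul_smul]
  norm_num

lemma trace_eq_zero_of_mem (hJJ : J * J = 1) (x : skewAdjointMatricesLieSubalgebra J) :
    (x : Matrix n n ℝ).trace = 0 := by
  have h := congrArg Matrix.trace (transpose_eq_of_mem hJJ x)
  rw [trace_transpose, trace_neg, Matrix.trace_mul_comm, ← Matrix.mul_assoc, hJJ,
    Matrix.one_mul] at h
  linarith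

/-- The Killing form of `𝔰𝔬(J)` is `n - 2` times the trace form of the standard representation. It
is computed on `𝔤𝔩(n)`, by composing with the projection `skewPart`. -/
lemma killingForm_skewAdjoint (hJt : Jᵀ = J) (hJJ : J * J = 1)
    (x y : skewAdjointMatricesLieSubalgebra J) :
    killingForm ℝ (skewAdjointMatricesLieSubalgebra J) x y
      = ((Fintype.card n : ℝ) - 2) * ((x : Matrix n n ℝ) * y).trace := by
  set X : Matrix n n ℝ := x.1
  set Y : Matrix n n ℝ := y.1
  let S := skewAdjointMatricesLieSubalgebra J
  let T : S →ₗ[ℝ] S := LieAlgebra.ad ℝ S x ∘ₗ LieAlgebra.ad ℝ S y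
  let ι : S →ₗ[ℝ] Matrix n n ℝ := S.toSubmodule.subtype
  have h1 : LinearMap.trace ℝ S T
      = LinearMap.trace ℝ (Matrix n n ℝ) (ι ∘ₗ (T ∘ₗ skewPart hJt hJJ)) := by
    have hT : T = (T ∘ₗ skewPart hJt hJJ) ∘ₗ ι :=
      LinearMap.ext fun z => (congrArg T (skewPart_coe hJt hJJ z)).symm
    exact (congrArg (LinearMap.trace ℝ S) hT).trans (LinearMap.trace_comp_comm' _ _)
  let t := (Matrix.transposeLinearEquiv n n ℝ ℝ).toLinearMap
  let M := fun a b : Matrix n n ℝ => LinearMap.mulLeft ℝ a ∘ₗ LinearMap.mulRight ℝ b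
  let N := fun a b : Matrix n n ℝ => LinearMap.mulLeft ℝ a ∘ₗ LinearMap.mulRight ℝ b ∘ₗ t
  have h2 : ι ∘ₗ (T ∘ₗ skewPart hJt hJJ) = (2⁻¹ : ℝ) •
      ((M (X * Y) 1 - M X Y - M Y X + M 1 (Y * X)) - (N (X * Y * J) J - N (X * J) (J * Y)
        - N (Y * J) (J * X) + N J (J * (Y * X)))) := by
    refine LinearMap.ext fun z => ?_
    change ⁅X, ⁅Y, (skewPart hJt hJJ z : Matrix n n ℝ)⁆⁆ = (2⁻¹ : ℝ) •
      ((X * Y * (z * 1) - X * (z * Y) - Y * (z * X) + 1 * (z * (Y * X))) -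
        (X * Y * J * (zᵀ * J) - X * J * (zᵀ * (J * Y)) - Y * J * (zᵀ * (J * X))
        + J * (zᵀ * (J * (Y * X)))))
    rw [coe_skewPart, lie_smul, lie_smul, Ring.lie_def, Ring.lie_def]
    congr 1
    noncomm_ring
  have hX : X.trace = 0 := trace_eq_zero_of_mem hJJ x
  have hXt : Xᵀ = -(J * X * J) := transpose_eq_of_mem hJJ x
  have hYt : Yᵀ = -(J * Y * J) := transpose_eq_of_mem hJJ y
  have hJJ' : ∀ Z : Matrix n n ℝ, J * (J * Z) = Z := fun Z => by
    rw [← Matrix.mul_assoc, hJJ, Matrix.one_mul]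
  have h3 : killingForm ℝ S x y = LinearMap.trace ℝ S T := rfl
  rw [h3, h1, h2]
  simp only [map_smul, map_sub, map_add, M, N, t, trace_mulLeft_comp_mulRight,
    trace_mulLeft_comp_mulRight_comp_transpose, hX, trace_one, transpose_mul, hJt, hXt, hYt]
  have hc : (Y * X).trace = (X * Y).trace := trace_mul_comm _ _
  have e1 : (X * Y * J * J).trace = (X * Y).trace := by
    rw [Matrix.mul_assoc, hJJ, Matrix.mul_one]
  have e2 : (X * J * (-(J * Y * J) * J)).trace = -(X * Y).trace := by
    simp only [neg_mul, mul_neg, Matrix.mul_assoc, hJJ, hJJ', Matrix.mul_one, trace_neg]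
  have e3 : (Y * J * (-(J * X * J) * J)).trace = -(X * Y).trace := by
    simp only [neg_mul, mul_neg, Matrix.mul_assoc, hJJ, hJJ', Matrix.mul_one, trace_neg, hc]
  have e4 : (J * (-(J * X * J) * -(J * Y * J) * J)).trace = (X * Y).trace := by
    simp only [neg_mul, mul_neg, neg_neg, Matrix.mul_assoc, hJJ, hJJ', Matrix.mul_one]
  rw [e1, e2, e3, e4, hc, smul_eq_mul]
  ring

/-- The skew-adjoint endomorphism `w ↦ ⟨b, w⟩ a - ⟨a, w⟩ b`. -/
def wedge (hJt : Jᵀ = J) (a b : n → ℝ) : skewAdjointMatricesLieSubalgebra J :=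
  ⟨vecMulVec a (J *ᵥ b) - vecMulVec b (J *ᵥ a), by
    rw [mem_skewAdjointMatricesLieSubalgebra_iff]
    have h : ∀ w : n → ℝ, w ᵥ* J = J *ᵥ w := fun w => by
      rw [← vecMul_transpose, hJt]
    simp only [transpose_sub, transpose_vecMulVec, sub_mul, vecMulVec_mul, neg_sub, mul_sub,
      mul_vecMulVec, h]⟩

lemma wedge_mulVec (hJt : Jᵀ = J) (a b w : n → ℝ) :
    (wedge hJt a b : Matrix n n ℝ) *ᵥ w = (b ⬝ᵥ J *ᵥ w) • a - (a ⬝ᵥ J *ᵥ w) • b := by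
  have h : ∀ c : n → ℝ, (J *ᵥ c) ⬝ᵥ w = c ⬝ᵥ J *ᵥ w := fun c => by
    rw [dotProduct_mulVec, ← vecMul_transpose, hJt]
  change (vecMulVec a (J *ᵥ b) - vecMulVec b (J *ᵥ a)) *ᵥ w = _
  rw [sub_mulVec, vecMulVec_mulVec, vecMulVec_mulVec, h, h]
  simp

lemma dotProduct_mulVec_skew (x : skewAdjointMatricesLieSubalgebra J)
    (a b : n → ℝ) : (x : Matrix n n ℝ) *ᵥ a ⬝ᵥ J *ᵥ b = -(a ⬝ᵥ J *ᵥ ((x : Matrix n n ℝ) *ᵥ b)) := by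
  rw [← vecMul_transpose, ← dotProduct_mulVec, mulVec_mulVec, transpose_mul_of_mem, neg_mulVec,
    dotProduct_neg, mulVec_mulVec]

lemma trace_mul_wedge (hJt : Jᵀ = J) (x : skewAdjointMatricesLieSubalgebra J) (a b : n → ℝ) :
    ((x : Matrix n n ℝ) * wedge hJt a b).trace
      = 2 * (b ⬝ᵥ J *ᵥ ((x : Matrix n n ℝ) *ᵥ a)) := by
  change ((x : Matrix n n ℝ) * (vecMulVec a (J *ᵥ b) - vecMulVec b (J *ᵥ a))).trace = _
  have h := dotProduct_mulVec_skew x b a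
  have h' := dotProduct_mulVec_comm hJt ((x : Matrix n n ℝ) *ᵥ a) b
  rw [mul_sub, mul_vecMulVec, mul_vecMulVec, trace_sub, trace_vecMulVec, trace_vecMulVec, h, h']
  ring


lemma eq_zero_of_forall_dotProduct_mulVec (hJJ : J * J = 1) (c : n → ℝ)
    (h : ∀ b, b ⬝ᵥ J *ᵥ c = 0) : c = 0 := by
  have h1 : J *ᵥ c = 0 := dotProduct_eq_zero _ fun b => by rw [dotProduct_comm, h]
  rw [← one_mulVec c, ← hJJ, ← mulVec_mulVec, h1, mulVec_zero]

/-- The double orthogonal complement of a line is that line. -/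
lemma exists_eq_smul_of_orthogonal (hJJ : J * J = 1) {v : n → ℝ} (hv : v ≠ 0)
    (c : n → ℝ) (h : ∀ b, b ⬝ᵥ J *ᵥ v = 0 → b ⬝ᵥ J *ᵥ c = 0) : ∃ t : ℝ, c = t • v := by
  obtain ⟨b₀, hb₀⟩ : ∃ b, b ⬝ᵥ J *ᵥ v ≠ 0 := by
    by_contra! h0
    exact hv (eq_zero_of_forall_dotProduct_mulVec hJJ v h0)
  refine ⟨(b₀ ⬝ᵥ J *ᵥ c) / (b₀ ⬝ᵥ J *ᵥ v), sub_eq_zero.1 ?_⟩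
  refine eq_zero_of_forall_dotProduct_mulVec hJJ _ fun b => ?_
  have h1 := h (b - ((b ⬝ᵥ J *ᵥ v) / (b₀ ⬝ᵥ J *ᵥ v)) • b₀) (by
    rw [sub_dotProduct, smul_dotProduct, smul_eq_mul, div_mul_cancel₀ _ hb₀, sub_self])
  rw [sub_dotProduct, smul_dotProduct, smul_eq_mul] at h1
  rw [mulVec_sub, mulVec_smul, dotProduct_sub, dotProduct_smul, smul_eq_mul]
  linear_combination h1

lemma isKilling_skewAdjoint (hJt : Jᵀ = J) (hJJ : J * J = 1) (hn : 2 < Fintype.card n) :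
    LieAlgebra.IsKilling ℝ (skewAdjointMatricesLieSubalgebra J) where
  killingCompl_top_eq_bot := by
    have hn' : ((Fintype.card n : ℝ) - 2) ≠ 0 := by
      have : (2 : ℝ) < Fintype.card n := by exact_mod_cast hn
      linarith
    refine (LieSubmodule.eq_bot_iff _).2 fun x hx => ?_
    rw [LieIdeal.mem_killingCompl] at hx
    ext1
    refine Matrix.mulVec_injective (funext fun a => ?_)
    refine (eq_zero_of_forall_dotProduct_mulVec hJJ _ fun b => ?_).trans
      (Matrix.zero_mulVec a).symm
    have h := hx (wedge hJt a b) (LieSubmodule.mem_top _)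
    rw [LieModule.traceForm_comm] at h
    have h' := (killingForm_skewAdjoint hJt hJJ x (wedge hJt a b)).symm.trans h
    rw [trace_mul_wedge] at h'
    simpa [hn'] using h'

/-- The stabiliser `𝔭` of a null line satisfies `⁅𝔭^⊥, 𝔤⁆ ⊆ 𝔭`: it comes from a `|1|`-grading. The
elements `z` of `𝔭^⊥` map `v^⊥` into the line, because `z` is orthogonal to `a ∧ b` for all
`a, b ∈ v^⊥`, and they kill `v`, because `z` is orthogonal to all `v ∧ b`. -/
lemma exists_lie_mulVec_eq_smul (hJt : Jᵀ = J) (hJJ : J * J = 1) {v : n → ℝ} (hv : v ≠ 0)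
    (hnull : v ⬝ᵥ J *ᵥ v = 0) (z : skewAdjointMatricesLieSubalgebra J)
    (hz : ∀ y : skewAdjointMatricesLieSubalgebra J, (∃ c : ℝ, (y : Matrix n n ℝ) *ᵥ v = c • v) →
      ((z : Matrix n n ℝ) * (y : Matrix n n ℝ)).trace = 0)
    (x : skewAdjointMatricesLieSubalgebra J) :
    ∃ c : ℝ, ((⁅z, x⁆ : skewAdjointMatricesLieSubalgebra J) : Matrix n n ℝ) *ᵥ v = c • v := by
  have hzv : (z : Matrix n n ℝ) *ᵥ v = 0 := by
    refine eq_zero_of_forall_dotProduct_mulVec hJJ _ fun b => ?_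
    have h := hz (wedge hJt v b) ⟨b ⬝ᵥ J *ᵥ v, by rw [wedge_mulVec, hnull]; simp⟩
    rw [trace_mul_wedge] at h
    linarith
  have hxv : v ⬝ᵥ J *ᵥ ((x : Matrix n n ℝ) *ᵥ v) = 0 := by
    have h1 := dotProduct_mulVec_skew x v v
    have h2 := dotProduct_mulVec_comm hJt ((x : Matrix n n ℝ) *ᵥ v) v
    linarith
  obtain ⟨t, ht⟩ := exists_eq_smul_of_orthogonal hJJ hv
    ((z : Matrix n n ℝ) *ᵥ ((x : Matrix n n ℝ) *ᵥ v)) fun b hb => by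
      have h := hz (wedge hJt ((x : Matrix n n ℝ) *ᵥ v) b) ⟨0, by
        rw [wedge_mulVec, hb, dotProduct_mulVec_comm hJt, hxv]; simp⟩
      rw [trace_mul_wedge] at h
      linarith
  refine ⟨t, ?_⟩
  rw [LieSubalgebra.coe_bracket, Ring.lie_def, sub_mulVec, ← mulVec_mulVec, ← mulVec_mulVec, hzv,
    mulVec_zero, sub_zero, ht]

end SkewAdjoint

section IndefiniteOrthogonal

open Matrix LieAlgebra.Orthogonal

variable (m n : Type*) [DecidableEq m] [DecidableEq n]

lemma transpose_indefiniteDiagonal :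
    (indefiniteDiagonal m n ℝ)ᵀ = indefiniteDiagonal m n ℝ := by
  simp [indefiniteDiagonal]

lemma indefiniteDiagonal_mul_self [Fintype m] [Fintype n] :
    indefiniteDiagonal m n ℝ * indefiniteDiagonal m n ℝ = 1 := by
  rw [indefiniteDiagonal, diagonal_mul_diagonal, ← diagonal_one]
  congr 1
  ext (i | i) <;> simp

/-- In signature `(1, 1)` every skew-adjoint matrix preserves both null lines. -/
lemma exists_mulVec_eq_smul_of_one_one {v : Fin 1 ⊕ Fin 1 → ℝ}
    (hnull : v ⬝ᵥ indefiniteDiagonal (Fin 1) (Fin 1) ℝ *ᵥ v = 0)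
    (x : so' (Fin 1) (Fin 1) ℝ) :
    ∃ c : ℝ, (x : Matrix (Fin 1 ⊕ Fin 1) (Fin 1 ⊕ Fin 1) ℝ) *ᵥ v = c • v := by
  obtain ⟨x, hx⟩ := x
  have hx' := (mem_skewAdjointMatricesLieSubalgebra_iff x).1 hx
  have h00 := congrFun₂ hx' (.inl 0) (.inl 0)
  have h01 := congrFun₂ hx' (.inl 0) (.inr 0)
  have h11 := congrFun₂ hx' (.inr 0) (.inr 0)
  simp [indefiniteDiagonal] at h00 h01 h11
  simp [indefiniteDiagonal, dotProduct, mulVec_diagonal] at hnull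
  have hsq : (v (.inl 0) - v (.inr 0)) * (v (.inl 0) + v (.inr 0)) = 0 := by
    linear_combination hnull
  have e00 : x (.inl 0) (.inl 0) = 0 := by linarith
  have e11 : x (.inr 0) (.inr 0) = 0 := by linarith
  have e10 : x (.inr 0) (.inl 0) = x (.inl 0) (.inr 0) := by linarith
  rcases mul_eq_zero.1 hsq with h | h
  · have hv : v (.inl 0) = v (.inr 0) := by linarith
    refine ⟨x (.inl 0) (.inr 0), ?_⟩
    ext (i | i) <;> fin_cases i <;> simp [mulVec, dotProduct, e00, e11, e10, hv]
  · have hv : v (.inl 0) = -v (.inr 0) := by linarith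
    refine ⟨-x (.inl 0) (.inr 0), ?_⟩
    ext (i | i) <;> fin_cases i <;> simp [mulVec, dotProduct, e00, e11, e10, hv]

end IndefiniteOrthogonal

/-! ### Pullbacks of one-forms and the exterior derivative -/

section Pullback

open Filter Topology

variable {E F X V : Type*} [NormedAddCommGroup E] [NormedSpace ℝ E]
  [NormedAddCommGroup F] [NormedSpace ℝ F] [TopologicalSpace X] [ChartedSpace E X]
  [NormedAddCommGroup V] [NormedSpace ℝ V]

/-- The pullback of the one-form `θ` along a map `f` defined on a vector space. -/
def pullbackForm (θ : ∀ x : X, TangentSpace 𝓘(ℝ, E) x →L[ℝ] F) (f : V → X) (y : V) : V →L[ℝ] F :=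
  (θ (f y)).comp (mfderiv 𝓘(ℝ, V) 𝓘(ℝ, E) f y)

variable [IsManifold 𝓘(ℝ, E) ∞ X]

lemma pullbackForm_eventuallyEq (θ : ∀ x : X, TangentSpace 𝓘(ℝ, E) x →L[ℝ] F) {f : V → X} {x : V}
    (hf : ContMDiffAt 𝓘(ℝ, V) 𝓘(ℝ, E) ∞ f x) :
    pullbackForm θ f =ᶠ[𝓝 x] fun y => (localForm θ (f x) (extChartAt 𝓘(ℝ, E) (f x) (f y))).comp
      (fderiv ℝ (fun y => extChartAt 𝓘(ℝ, E) (f x) (f y)) y) := by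
  have h1 : ∀ᶠ y in 𝓝 x, ContMDiffAt 𝓘(ℝ, V) 𝓘(ℝ, E) 1 f y :=
    (contMDiffAt_iff_contMDiffAt_nhds (n := 1) (by simp)).1 (hf.of_le (by simp))
  have h2 : ∀ᶠ y in 𝓝 x, f y ∈ (extChartAt 𝓘(ℝ, E) (f x)).source :=
    hf.continuousAt.eventually (extChartAt_source_mem_nhds (I := 𝓘(ℝ, E)) (f x))
  filter_upwards [h1, h2, h2.eventually_nhds] with y hy1 hy2 hy3
  set φ := extChartAt 𝓘(ℝ, E) (f x)
  have hfy : MDifferentiableAt 𝓘(ℝ, V) 𝓘(ℝ, E) f y := hy1.mdifferentiableAt (by simp)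
  have hφ : MDifferentiableAt 𝓘(ℝ, E) 𝓘(ℝ, E) φ (f y) :=
    mdifferentiableAt_extChartAt (by simpa [φ] using hy2)
  have hφs : MDifferentiableAt 𝓘(ℝ, E) 𝓘(ℝ, E) φ.symm (φ (f y)) := by
    have := (contMDiffOn_extChartAt_symm (I := 𝓘(ℝ, E)) (n := ∞) (f x)).contMDiffAt
      (extChartAt_target_mem_nhds' (φ.map_source hy2))
    exact this.mdifferentiableAt (by simp)
  have hg : MDifferentiableAt 𝓘(ℝ, V) 𝓘(ℝ, E) (fun y => φ (f y)) y := hφ.comp y hfy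
  have hc : mfderiv 𝓘(ℝ, V) 𝓘(ℝ, E) (φ.symm ∘ fun y => φ (f y)) y
      = (mfderiv 𝓘(ℝ, E) 𝓘(ℝ, E) φ.symm (φ (f y))).comp
        (mfderiv 𝓘(ℝ, V) 𝓘(ℝ, E) (fun y => φ (f y)) y) := mfderiv_comp y hφs hg
  have he : (φ.symm ∘ fun y => φ (f y)) =ᶠ[𝓝 y] f := by
    filter_upwards [hy3] with z hz
    exact φ.left_inv hz
  have hv : φ.symm (φ (f y)) = f y := φ.left_inv hy2
  let θ' : X → (E →L[ℝ] F) := θ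
  have key : ∀ w : V, θ' (f y) (mfderiv 𝓘(ℝ, V) 𝓘(ℝ, E) f y w)
      = θ' (φ.symm (φ (f y))) (mfderiv 𝓘(ℝ, E) 𝓘(ℝ, E) φ.symm (φ (f y))
        (fderiv ℝ (fun y => φ (f y)) y w)) := by
    intro w
    rw [hv]
    congr 1
    rw [← mfderiv_eq_fderiv]
    have h5 := congrArg (fun A : V →L[ℝ] E => A w) hc
    have h6 := congrArg (fun A : V →L[ℝ] E => A w)
      (he.mfderiv_eq (I := 𝓘(ℝ, V)) (I' := 𝓘(ℝ, E)))
    exact h6.symm.trans h5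
  ext w
  exact key w

/-- The exterior derivative can be computed after pulling back to a vector space. The second
derivatives of the map cancel, by their symmetry. -/
lemma extDer_pullback (θ : ∀ x : X, TangentSpace 𝓘(ℝ, E) x →L[ℝ] F) {f : V → X} {x : V}
    (hf : ContMDiffAt 𝓘(ℝ, V) 𝓘(ℝ, E) ∞ f x)
    (hθ : DifferentiableAt ℝ (localForm θ (f x)) (extChartAt 𝓘(ℝ, E) (f x) (f x))) :
    DifferentiableAt ℝ (pullbackForm θ f) x ∧ ∀ ξ η : V,
      extDer θ (f x) (mfderiv 𝓘(ℝ, V) 𝓘(ℝ, E) f x ξ) (mfderiv 𝓘(ℝ, V) 𝓘(ℝ, E) f x η)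
        = fderiv ℝ (pullbackForm θ f) x ξ η - fderiv ℝ (pullbackForm θ f) x η ξ := by
  set φ := extChartAt 𝓘(ℝ, E) (f x) with hφdef
  set g : V → E := fun y => φ (f y) with hgdef
  have hg : ContDiffAt ℝ ∞ g x := by
    rw [← contMDiffAt_iff_contDiffAt]
    exact (contMDiffAt_extChartAt (I := 𝓘(ℝ, E)) (x := f x)).comp x hf
  have hfx : MDifferentiableAt 𝓘(ℝ, V) 𝓘(ℝ, E) f x := hf.mdifferentiableAt (by simp)
  have hg' : fderiv ℝ g x = (mfderiv 𝓘(ℝ, E) 𝓘(ℝ, E) φ (f x)).comp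
      (mfderiv 𝓘(ℝ, V) 𝓘(ℝ, E) f x) := by
    rw [← mfderiv_eq_fderiv]
    exact mfderiv_comp x (mdifferentiableAt_extChartAt (by simp)) hfx
  have hg2 : DifferentiableAt ℝ (fderiv ℝ g) x :=
    (hg.fderiv_right (m := 1) (by rw [one_add_one_eq_two]; exact ENat.LEInfty.out)).differentiableAt
      (by simp)
  have hsymm : ∀ ξ η, fderiv ℝ (fderiv ℝ g) x ξ η = fderiv ℝ (fderiv ℝ g) x η ξ :=
    fun ξ η => (hg.isSymmSndFDerivAt (by
      rw [minSmoothness_of_isRCLikeNormedField]; exact ENat.LEInfty.out)) ξ η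
  have hL : HasFDerivAt (fun y => localForm θ (f x) (g y))
      ((fderiv ℝ (localForm θ (f x)) (g x)).comp (fderiv ℝ g x)) x :=
    HasFDerivAt.comp (g := localForm θ (f x)) (f := g) x hθ.hasFDerivAt
      (hg.differentiableAt (by simp)).hasFDerivAt
  have hD := (hL.clm_comp hg2.hasFDerivAt).congr_of_eventuallyEq (pullbackForm_eventuallyEq θ hf)
  refine ⟨hD.differentiableAt, fun ξ η => ?_⟩
  have e : ∀ ζ, (mfderiv 𝓘(ℝ, E) 𝓘(ℝ, E) φ (f x) (mfderiv 𝓘(ℝ, V) 𝓘(ℝ, E) f x ζ) : E)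
      = fderiv ℝ g x ζ := fun ζ => by rw [hg']; rfl
  rw [hD.fderiv]
  change fderiv ℝ (localForm θ (f x)) (φ (f x)) _ _ - fderiv ℝ (localForm θ (f x)) (φ (f x)) _ _ = _
  rw [← hφdef]
  simp only [add_apply, ContinuousLinearMap.comp_apply,
    ContinuousLinearMap.compL_apply, ContinuousLinearMap.flip_apply, hsymm ξ η]
  rw [add_sub_add_left_eq_sub]
  exact congrArg₂ (fun a b : E => fderiv ℝ (localForm θ (f x)) (φ (f x)) a b
    - fderiv ℝ (localForm θ (f x)) (φ (f x)) b a) (e ξ) (e η)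

end Pullback

/-! ### Naturality of the exterior derivative -/

section Naturality

open Filter Topology

variable {E F X : Type*} [NormedAddCommGroup E] [NormedSpace ℝ E]
  [NormedAddCommGroup F] [NormedSpace ℝ F] [TopologicalSpace X] [ChartedSpace E X]

lemma IsSmoothForm.differentiableAt {θ : ∀ x : X, TangentSpace 𝓘(ℝ, E) x →L[ℝ] F}
    (hθ : IsSmoothForm θ) (x : X) :
    DifferentiableAt ℝ (localForm θ x) (extChartAt 𝓘(ℝ, E) x x) :=
  ((hθ x).contDiffAt (extChartAt_target_mem_nhds x)).differentiableAt (by simp)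

variable [IsManifold 𝓘(ℝ, E) ∞ X]

lemma mfderiv_extChartAt_symm_self (x : X) :
    (mfderiv 𝓘(ℝ, E) 𝓘(ℝ, E) (extChartAt 𝓘(ℝ, E) x).symm (extChartAt 𝓘(ℝ, E) x x) : E →L[ℝ] E)
      = ContinuousLinearMap.id ℝ E := by
  have h := mfderivWithin_range_extChartAt_symm (I := 𝓘(ℝ, E)) (x := x)
  rw [ModelWithCorners.range_eq_univ, mfderivWithin_univ] at h
  exact h

lemma contMDiffAt_extChartAt_symm (x : X) :
    ContMDiffAt 𝓘(ℝ, E) 𝓘(ℝ, E) ∞ (extChartAt 𝓘(ℝ, E) x).symm (extChartAt 𝓘(ℝ, E) x x) :=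
  (contMDiffOn_extChartAt_symm (I := 𝓘(ℝ, E)) (n := ∞) x).contMDiffAt
    (extChartAt_target_mem_nhds x)

/-- In the chart at `x`, tangent vectors at `x` are their own coordinates. -/
lemma extDer_eq (θ : ∀ x : X, TangentSpace 𝓘(ℝ, E) x →L[ℝ] F) (x : X) (ξ η : E) :
    extDer θ x ξ η = fderiv ℝ (localForm θ x) (extChartAt 𝓘(ℝ, E) x x) ξ η
      - fderiv ℝ (localForm θ x) (extChartAt 𝓘(ℝ, E) x x) η ξ := by
  have h : ∀ ζ : E, (mfderiv 𝓘(ℝ, E) 𝓘(ℝ, E) (extChartAt 𝓘(ℝ, E) x) x : E →L[ℝ] E) ζ = ζ := by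
    intro ζ
    have := mfderiv_extChartAt_self (I := 𝓘(ℝ, E)) (x := x)
    exact congrArg (fun A : E →L[ℝ] E => A ζ) this
  exact congrArg₂ (fun a b : E => fderiv ℝ (localForm θ x) (extChartAt 𝓘(ℝ, E) x x) a b
    - fderiv ℝ (localForm θ x) (extChartAt 𝓘(ℝ, E) x x) b a) (h ξ) (h η)

variable {E' F' Y : Type*} [NormedAddCommGroup E'] [NormedSpace ℝ E']
  [NormedAddCommGroup F'] [NormedSpace ℝ F'] [TopologicalSpace Y] [ChartedSpace E' Y]
  [IsManifold 𝓘(ℝ, E') ∞ Y]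

/-- Naturality of the exterior derivative: `j^* θ' = ρ ∘ θ` implies `j^* dθ' = ρ ∘ dθ`. -/
lemma extDer_map (θ : ∀ x : X, TangentSpace 𝓘(ℝ, E) x →L[ℝ] F)
    (θ' : ∀ y : Y, TangentSpace 𝓘(ℝ, E') y →L[ℝ] F') (ρ : F →L[ℝ] F') {j : X → Y} {x : X} {y : Y}
    (hxy : j x = y) (hj : ContMDiffAt 𝓘(ℝ, E) 𝓘(ℝ, E') ∞ j x)
    (hθ : DifferentiableAt ℝ (localForm θ x) (extChartAt 𝓘(ℝ, E) x x))
    (hθ' : DifferentiableAt ℝ (localForm θ' y) (extChartAt 𝓘(ℝ, E') y y))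
    (h : ∀ᶠ x' in 𝓝 x, ∀ ξ : E, (θ' (j x') : E' →L[ℝ] F')
      ((mfderiv 𝓘(ℝ, E) 𝓘(ℝ, E') j x' : E →L[ℝ] E') ξ) = ρ ((θ x' : E →L[ℝ] F) ξ))
    (ξ η : E) :
    extDer θ' y ((mfderiv 𝓘(ℝ, E) 𝓘(ℝ, E') j x : E →L[ℝ] E') ξ)
      ((mfderiv 𝓘(ℝ, E) 𝓘(ℝ, E') j x : E →L[ℝ] E') η) = ρ (extDer θ x ξ η) := by
  set φ := extChartAt 𝓘(ℝ, E) x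
  have hφx : φ.symm (φ x) = x := extChartAt_to_inv x
  have hsymm : ContMDiffAt 𝓘(ℝ, E) 𝓘(ℝ, E) ∞ φ.symm (φ x) := contMDiffAt_extChartAt_symm x
  have hj' : ContMDiffAt 𝓘(ℝ, E) 𝓘(ℝ, E') ∞ (j ∘ φ.symm) (φ x) :=
    ContMDiffAt.comp (φ x) (by rwa [hφx]) hsymm
  have hval : (j ∘ φ.symm) (φ x) = y := by simp [hφx, hxy]
  obtain ⟨-, hD⟩ := extDer_pullback θ' hj' (by rwa [hval])
  have hder : ∀ ζ : E, (mfderiv 𝓘(ℝ, E) 𝓘(ℝ, E') (j ∘ φ.symm) (φ x) : E →L[ℝ] E') ζ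
      = (mfderiv 𝓘(ℝ, E) 𝓘(ℝ, E') j x : E →L[ℝ] E') ζ := by
    intro ζ
    have hjm : MDifferentiableAt 𝓘(ℝ, E) 𝓘(ℝ, E') j (φ.symm (φ x)) := by
      rw [hφx]; exact hj.mdifferentiableAt (by simp)
    have h1 : (mfderiv 𝓘(ℝ, E) 𝓘(ℝ, E') (j ∘ φ.symm) (φ x) : E →L[ℝ] E')
        = (mfderiv 𝓘(ℝ, E) 𝓘(ℝ, E') j (φ.symm (φ x)) : E →L[ℝ] E').comp
          (mfderiv 𝓘(ℝ, E) 𝓘(ℝ, E) φ.symm (φ x) : E →L[ℝ] E) :=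
      mfderiv_comp _ hjm (hsymm.mdifferentiableAt (by simp))
    rw [h1, mfderiv_extChartAt_symm_self, hφx]
    rfl
  have hev : pullbackForm θ' (j ∘ φ.symm) =ᶠ[𝓝 (φ x)] fun a => ρ.comp (localForm θ x a) := by
    have h1 : ∀ᶠ a in 𝓝 (φ x), ContMDiffAt 𝓘(ℝ, E) 𝓘(ℝ, E) 1 φ.symm a :=
      (contMDiffAt_iff_contMDiffAt_nhds (n := 1) (by simp)).1 (hsymm.of_le (by simp))
    have h1' : ∀ᶠ x' in 𝓝 x, ContMDiffAt 𝓘(ℝ, E) 𝓘(ℝ, E') 1 j x' :=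
      (contMDiffAt_iff_contMDiffAt_nhds (n := 1) (by simp)).1 (hj.of_le (by simp))
    have hcont : Tendsto φ.symm (𝓝 (φ x)) (𝓝 x) := by
      have := hsymm.continuousAt
      rwa [ContinuousAt, hφx] at this
    filter_upwards [h1, hcont.eventually h1', hcont.eventually h] with a ha1 ha2 ha3
    ext ζ
    have hc : (mfderiv 𝓘(ℝ, E) 𝓘(ℝ, E') (j ∘ φ.symm) a : E →L[ℝ] E')
        = (mfderiv 𝓘(ℝ, E) 𝓘(ℝ, E') j (φ.symm a) : E →L[ℝ] E').comp
          (mfderiv 𝓘(ℝ, E) 𝓘(ℝ, E) φ.symm a : E →L[ℝ] E) :=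
      mfderiv_comp _ (ha2.mdifferentiableAt (by simp)) (ha1.mdifferentiableAt (by simp))
    have h2 := ha3 ((mfderiv 𝓘(ℝ, E) 𝓘(ℝ, E) φ.symm a : E →L[ℝ] E) ζ)
    refine Eq.trans ?_ h2
    exact congrArg (θ' (j (φ.symm a)) : E' →L[ℝ] F') (congrArg (fun A : E →L[ℝ] E' => A ζ) hc)
  have hfd : fderiv ℝ (pullbackForm θ' (j ∘ φ.symm)) (φ x)
      = (ContinuousLinearMap.compL ℝ E F F' ρ).comp (fderiv ℝ (localForm θ x) (φ x)) := by
    rw [hev.fderiv_eq]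
    exact ((ContinuousLinearMap.compL ℝ E F F' ρ).hasFDerivAt.comp (φ x) hθ.hasFDerivAt).fderiv
  have h3 := hD ξ η
  rw [hfd] at h3
  have h4 : extDer θ' y ((mfderiv 𝓘(ℝ, E) 𝓘(ℝ, E') (j ∘ φ.symm) (φ x) : E →L[ℝ] E') ξ)
      ((mfderiv 𝓘(ℝ, E) 𝓘(ℝ, E') (j ∘ φ.symm) (φ x) : E →L[ℝ] E') η)
      = ρ (fderiv ℝ (localForm θ x) (φ x) ξ η) - ρ (fderiv ℝ (localForm θ x) (φ x) η ξ) := by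
    rw [← hval]
    exact h3
  rw [hder, hder] at h4
  rw [h4, extDer_eq, map_sub]

end Naturality

/-! ### Tangent maps -/

section TangentMaps

open Filter Topology

/-- The derivative of a map between manifolds, as a map between the model spaces. (All tangent
spaces are copies of the model space; forgetting the base point makes rewriting possible.) -/
def tderiv (E E' : Type*) [NormedAddCommGroup E] [NormedSpace ℝ E] [NormedAddCommGroup E']
    [NormedSpace ℝ E'] {X Y : Type*} [TopologicalSpace X] [ChartedSpace E X] [TopologicalSpace Y]
    [ChartedSpace E' Y] (f : X → Y) (x : X) : E →L[ℝ] E' :=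
  mfderiv 𝓘(ℝ, E) 𝓘(ℝ, E') f x

variable {E X E' Y E'' Z : Type*} [NormedAddCommGroup E] [NormedSpace ℝ E]
  [TopologicalSpace X] [ChartedSpace E X]
  [NormedAddCommGroup E'] [NormedSpace ℝ E'] [TopologicalSpace Y] [ChartedSpace E' Y]
  [NormedAddCommGroup E''] [NormedSpace ℝ E''] [TopologicalSpace Z] [ChartedSpace E'' Z]

lemma tderiv_comp {g : Y → Z} {f : X → Y} {x : X}
    (hg : MDifferentiableAt 𝓘(ℝ, E') 𝓘(ℝ, E'') g (f x))
    (hf : MDifferentiableAt 𝓘(ℝ, E) 𝓘(ℝ, E') f x) :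
    tderiv E E'' (fun x => g (f x)) x = (tderiv E' E'' g (f x)).comp (tderiv E E' f x) :=
  mfderiv_comp x hg hf

lemma tderiv_comp_of_eq {g : Y → Z} {f : X → Y} {x : X} {y : Y} (h : f x = y)
    (hg : MDifferentiableAt 𝓘(ℝ, E') 𝓘(ℝ, E'') g y)
    (hf : MDifferentiableAt 𝓘(ℝ, E) 𝓘(ℝ, E') f x) :
    tderiv E E'' (fun x => g (f x)) x = (tderiv E' E'' g y).comp (tderiv E E' f x) := by
  subst h
  exact tderiv_comp hg hf

lemma tderiv_eq_fderiv (f : E → E') (x : E) : tderiv E E' f x = fderiv ℝ f x :=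
  mfderiv_eq_fderiv

lemma tderiv_id (x : X) : tderiv E E (fun x : X => x) x = ContinuousLinearMap.id ℝ E :=
  mfderiv_id

lemma contMDiffAt_extChartAt_symm_of_mem [IsManifold 𝓘(ℝ, E) ∞ X] {x : X} {a : E}
    (ha : a ∈ (extChartAt 𝓘(ℝ, E) x).target) :
    ContMDiffAt 𝓘(ℝ, E) 𝓘(ℝ, E) ∞ (extChartAt 𝓘(ℝ, E) x).symm a :=
  (contMDiffOn_extChartAt_symm x).contMDiffAt ((isOpen_extChartAt_target x).mem_nhds ha)

variable [IsManifold 𝓘(ℝ, E) ∞ X]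

lemma tderiv_extChartAt (x : X) :
    tderiv E E (extChartAt 𝓘(ℝ, E) x) x = ContinuousLinearMap.id ℝ E :=
  mfderiv_extChartAt_self

lemma tderiv_extChartAt_symm (x : X) :
    tderiv E E (extChartAt 𝓘(ℝ, E) x).symm (extChartAt 𝓘(ℝ, E) x x)
      = ContinuousLinearMap.id ℝ E :=
  mfderiv_extChartAt_symm_self x

lemma extDer_pullback_of_eq {V F : Type*} [NormedAddCommGroup V] [NormedSpace ℝ V]
    [NormedAddCommGroup F] [NormedSpace ℝ F] (θ : X → E →L[ℝ] F) {f : V → X} {x : V} {x₀ : X}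
    (hx : f x = x₀) (hf : ContMDiffAt 𝓘(ℝ, V) 𝓘(ℝ, E) ∞ f x)
    (hθ : DifferentiableAt ℝ (localForm θ x₀) (extChartAt 𝓘(ℝ, E) x₀ x₀)) :
    DifferentiableAt ℝ (fun y => (θ (f y)).comp (tderiv V E f y)) x ∧ ∀ ξ η : V,
      extDer θ x₀ (tderiv V E f x ξ) (tderiv V E f x η)
        = fderiv ℝ (fun y => (θ (f y)).comp (tderiv V E f y)) x ξ η
          - fderiv ℝ (fun y => (θ (f y)).comp (tderiv V E f y)) x η ξ := by
  subst hx
  exact extDer_pullback θ hf hθ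

end TangentMaps

/-! ### Equivariant one-forms and fundamental vector fields -/

section FundamentalFields

open Filter Topology

variable {EX X EH H F : Type*} [NormedAddCommGroup EX] [NormedSpace ℝ EX]
  [TopologicalSpace X] [ChartedSpace EX X] [IsManifold 𝓘(ℝ, EX) ∞ X]
  [NormedAddCommGroup EH] [NormedSpace ℝ EH] [TopologicalSpace H] [ChartedSpace EH H]
  [Group H] [LieGroup 𝓘(ℝ, EH) ∞ H] [NormedAddCommGroup F] [NormedSpace ℝ F]

/-- For an equivariant one-form `θ` whose values on fundamental vector fields are constant, the
exterior derivative in a fundamental direction is minus the derivative of the representation. It is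
computed in the coordinates `(a, k) ↦ a · k`: in the term `D_ξ (θ(ζ_A))` a constant function is
differentiated. -/
lemma extDer_fundamental (θ : X → EX →L[ℝ] F) (act : X → H → X)
    (hact : ContMDiff (𝓘(ℝ, EX).prod 𝓘(ℝ, EH)) 𝓘(ℝ, EX) ∞ fun z : X × H => act z.1 z.2)
    (act_one : ∀ u, act u 1 = u) (R : H → F →L[ℝ] F)
    (hR : ∀ h u (ξ : EX), θ (act u h) (tderiv EX EX (fun v => act v h) u ξ)
      = R h (θ u ξ))
    (s : EH → F)
    (hs : ∀ u A, θ (act u 1) (tderiv EH EX (fun h => act u h) 1 A) = s A)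
    (u : X) (hθ : DifferentiableAt ℝ (localForm θ u) (extChartAt 𝓘(ℝ, EX) u u))
    (ξ : EX) (A : EH) :
    DifferentiableAt ℝ (fun k => R ((extChartAt 𝓘(ℝ, EH) (1 : H)).symm k)
      (θ u ξ)) (extChartAt 𝓘(ℝ, EH) (1 : H) 1) ∧
    extDer θ u ξ (tderiv EH EX (fun h => act u h) 1 A)
      = -fderiv ℝ (fun k => R ((extChartAt 𝓘(ℝ, EH) (1 : H)).symm k)
        (θ u ξ)) (extChartAt 𝓘(ℝ, EH) (1 : H) 1) A := by
  set φ := extChartAt 𝓘(ℝ, EX) u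
  set χ := extChartAt 𝓘(ℝ, EH) (1 : H)
  have hφu : φ.symm (φ u) = u := extChartAt_to_inv u
  have hχ1 : χ.symm (χ 1) = 1 := extChartAt_to_inv (1 : H)
  have hφs : ContMDiffAt 𝓘(ℝ, EX) 𝓘(ℝ, EX) ∞ φ.symm (φ u) := contMDiffAt_extChartAt_symm u
  have hχs : ContMDiffAt 𝓘(ℝ, EH) 𝓘(ℝ, EH) ∞ χ.symm (χ 1) := contMDiffAt_extChartAt_symm (1 : H)
  let f : EX × EH → X := fun y => act (φ.symm y.1) (χ.symm y.2)
  have hpair : ∀ a k, ContMDiffAt 𝓘(ℝ, EX) 𝓘(ℝ, EX) ∞ φ.symm a →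
      ContMDiffAt 𝓘(ℝ, EH) 𝓘(ℝ, EH) ∞ χ.symm k →
      ContMDiffAt 𝓘(ℝ, EX × EH) 𝓘(ℝ, EX) ∞ f (a, k) := by
    intro a k ha hk
    have h1 : ContMDiffAt 𝓘(ℝ, EX × EH) 𝓘(ℝ, EX) ∞ (fun y : EX × EH => φ.symm y.1) (a, k) :=
      ContMDiffAt.comp (g := φ.symm) (f := Prod.fst) (a, k) ha
        contDiff_fst.contMDiff.contMDiffAt
    have h2 : ContMDiffAt 𝓘(ℝ, EX × EH) 𝓘(ℝ, EH) ∞ (fun y : EX × EH => χ.symm y.2) (a, k) :=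
      ContMDiffAt.comp (g := χ.symm) (f := Prod.snd) (a, k) hk
        contDiff_snd.contMDiff.contMDiffAt
    exact hact.contMDiffAt.comp (a, k) (h1.prodMk h2)
  set z : EX × EH := (φ u, χ 1)
  have hf : ContMDiffAt 𝓘(ℝ, EX × EH) 𝓘(ℝ, EX) ∞ f z := hpair _ _ hφs hχs
  have hfz : f z = u := by simp [f, z, hφu, hχ1, act_one]
  have hχe : ∀ᶠ a in 𝓝 (χ 1), ContMDiffAt 𝓘(ℝ, EH) 𝓘(ℝ, EH) ∞ χ.symm a := by
    filter_upwards [extChartAt_target_mem_nhds (I := 𝓘(ℝ, EH)) (1 : H)] with a ha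
    exact contMDiffAt_extChartAt_symm_of_mem ha
  have hφe : ∀ᶠ a in 𝓝 (φ u), ContMDiffAt 𝓘(ℝ, EX) 𝓘(ℝ, EX) ∞ φ.symm a := by
    filter_upwards [extChartAt_target_mem_nhds (I := 𝓘(ℝ, EX)) u] with a ha
    exact contMDiffAt_extChartAt_symm_of_mem ha
  -- the partial derivatives of `f`
  have hleft : ∀ a k, ContMDiffAt 𝓘(ℝ, EX) 𝓘(ℝ, EX) ∞ φ.symm a →
      ContMDiffAt 𝓘(ℝ, EH) 𝓘(ℝ, EH) ∞ χ.symm k → ∀ ζ, tderiv (EX × EH) EX f (a, k) (ζ, 0)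
        = tderiv EX EX (fun v => act v (χ.symm k)) (φ.symm a) (tderiv EX EX φ.symm a ζ) := by
    intro a k ha hk ζ
    have h1 : tderiv EX EX (fun a => f (a, k)) a
        = (tderiv (EX × EH) EX f (a, k)).comp (tderiv EX (EX × EH) (fun a => (a, k)) a) :=
      tderiv_comp (f := fun a => (a, k)) ((hpair a k ha hk).mdifferentiableAt (by simp))
        (mdifferentiableAt_iff_differentiableAt.2 (by fun_prop))
    have h2 : tderiv EX EX (fun a => f (a, k)) a
        = (tderiv EX EX (fun v => act v (χ.symm k)) (φ.symm a)).comp (tderiv EX EX φ.symm a) :=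
      tderiv_comp (g := fun v => act v (χ.symm k))
        ((hact.comp (contMDiff_id.prodMk contMDiff_const)).mdifferentiableAt (by simp))
        (ha.mdifferentiableAt (by simp))
    rw [tderiv_eq_fderiv, (hasFDerivAt_prodMk_left a k).fderiv, h2] at h1
    exact (DFunLike.congr_fun h1 ζ).symm
  have hright : ∀ a k, ContMDiffAt 𝓘(ℝ, EX) 𝓘(ℝ, EX) ∞ φ.symm a →
      ContMDiffAt 𝓘(ℝ, EH) 𝓘(ℝ, EH) ∞ χ.symm k → ∀ ζ, tderiv (EX × EH) EX f (a, k) (0, ζ)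
        = tderiv EH EX (fun h => act (φ.symm a) h) (χ.symm k) (tderiv EH EH χ.symm k ζ) := by
    intro a k ha hk ζ
    have h1 : tderiv EH EX (fun k => f (a, k)) k
        = (tderiv (EX × EH) EX f (a, k)).comp (tderiv EH (EX × EH) (fun k => (a, k)) k) :=
      tderiv_comp (f := fun k => (a, k)) ((hpair a k ha hk).mdifferentiableAt (by simp))
        (mdifferentiableAt_iff_differentiableAt.2 (by fun_prop))
    have h2 : tderiv EH EX (fun k => f (a, k)) k
        = (tderiv EH EX (fun h => act (φ.symm a) h) (χ.symm k)).comp (tderiv EH EH χ.symm k) :=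
      tderiv_comp (g := fun h => act (φ.symm a) h)
        ((hact.comp (contMDiff_const.prodMk contMDiff_id)).mdifferentiableAt (by simp))
        (hk.mdifferentiableAt (by simp))
    rw [tderiv_eq_fderiv, (hasFDerivAt_prodMk_right a k).fderiv, h2] at h1
    exact (DFunLike.congr_fun h1 ζ).symm
  obtain ⟨hP, hD⟩ := extDer_pullback_of_eq θ hfz hf hθ
  set P : EX × EH → (EX × EH →L[ℝ] F) := fun y => (θ (f y)).comp (tderiv (EX × EH) EX f y)
  have hP1 : (fun k => R (χ.symm k) (θ u ξ)) =ᶠ[𝓝 (χ 1)] fun k => P (φ u, k) (ξ, 0) := by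
    filter_upwards [hχe] with k hk
    change _ = θ (act (φ.symm (φ u)) (χ.symm k)) (tderiv (EX × EH) EX f (φ u, k) (ξ, 0))
    rw [hleft _ _ hφs hk, hR, tderiv_extChartAt_symm, hφu]
    rfl
  have hP2 : (fun _ => s A) =ᶠ[𝓝 (φ u)] fun a => P (a, χ 1) (0, A) := by
    filter_upwards [hφe] with a ha
    change _ = θ (act (φ.symm a) (χ.symm (χ 1))) (tderiv (EX × EH) EX f (a, χ 1) (0, A))
    rw [hright _ _ ha hχs, tderiv_extChartAt_symm, hχ1]
    exact (hs _ _).symm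
  have hd1 : HasFDerivAt (fun k => P (φ u, k) (ξ, 0))
      (((fderiv ℝ P z).comp (ContinuousLinearMap.inr ℝ EX EH)).flip (ξ, 0)) (χ 1) :=
    (ContinuousLinearMap.apply ℝ F ((ξ, 0) : EX × EH)).hasFDerivAt.comp (χ 1)
      (HasFDerivAt.comp (f := fun k => (φ u, k)) (g := P) (χ 1) hP.hasFDerivAt
        (hasFDerivAt_prodMk_right (φ u) (χ 1)))
  have hd2 : HasFDerivAt (fun a => P (a, χ 1) (0, A))
      (((fderiv ℝ P z).comp (ContinuousLinearMap.inl ℝ EX EH)).flip (0, A)) (φ u) :=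
    (ContinuousLinearMap.apply ℝ F ((0, A) : EX × EH)).hasFDerivAt.comp (φ u)
      (HasFDerivAt.comp (f := fun a => (a, χ 1)) (g := P) (φ u) hP.hasFDerivAt
        (hasFDerivAt_prodMk_left (φ u) (χ 1)))
  have hd1' := hd1.congr_of_eventuallyEq hP1
  have hd2' := (hd2.congr_of_eventuallyEq hP2).unique (hasFDerivAt_const (s A) (φ u))
  refine ⟨hd1'.differentiableAt, ?_⟩
  have h := hD (ξ, 0) (0, A)
  have e1 : tderiv (EX × EH) EX f z (ξ, 0) = ξ := by
    rw [hleft _ _ hφs hχs, tderiv_extChartAt_symm, hφu, hχ1]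
    simp only [act_one, tderiv_id]
    rfl
  have e2 : tderiv (EX × EH) EX f z (0, A) = tderiv EH EX (fun h => act u h) 1 A := by
    rw [hright _ _ hφs hχs, tderiv_extChartAt_symm, hφu, hχ1]
    rfl
  have e3 : fderiv ℝ P z (ξ, 0) (0, A) = 0 := DFunLike.congr_fun hd2' ξ
  rw [e1, e2, e3, zero_sub] at h
  rw [h, hd1'.fderiv]
  rfl

end FundamentalFields

/-! ### The Maurer–Cartan form -/

section LieGroups

open Filter Topology VectorField

variable {E G : Type*} [NormedAddCommGroup E] [NormedSpace ℝ E]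
  [TopologicalSpace G] [ChartedSpace E G] [Group G] [LieGroup 𝓘(ℝ, E) ∞ G]

lemma contMDiff_mul_left' (g : G) : ContMDiff 𝓘(ℝ, E) 𝓘(ℝ, E) ∞ (fun x : G => g * x) :=
  contMDiff_mul_left

lemma contMDiff_mul_right' (g : G) : ContMDiff 𝓘(ℝ, E) 𝓘(ℝ, E) ∞ (fun x : G => x * g) :=
  contMDiff_mul_right

lemma contMDiff_conj (g : G) : ContMDiff 𝓘(ℝ, E) 𝓘(ℝ, E) ∞ (fun x : G => g * x * g⁻¹) :=
  (contMDiff_mul_right' g⁻¹).comp (contMDiff_mul_left' g)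

/-- The left Maurer–Cartan form of a Lie group. -/
def maurerCartan (E : Type*) [NormedAddCommGroup E] [NormedSpace ℝ E] {G : Type*}
    [TopologicalSpace G] [ChartedSpace E G] [Group G] (g : G) : E →L[ℝ] E :=
  tderiv E E (fun x : G => g⁻¹ * x) g

lemma maurerCartan_tderiv_mul_left (g : G) (v : E) :
    maurerCartan E g (tderiv E E (fun x : G => g * x) 1 v) = v := by
  have h := tderiv_comp_of_eq (E := E) (E' := E) (E'' := E) (g := fun x : G => g⁻¹ * x)
    (f := fun x : G => g * x) (x := 1) (y := g) (mul_one g)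
    ((contMDiff_mul_left' g⁻¹).mdifferentiableAt (by simp))
    ((contMDiff_mul_left' g).mdifferentiableAt (by simp))
  simp only [inv_mul_cancel_left, tderiv_id] at h
  exact (DFunLike.congr_fun h v).symm

/-- Right translations act on the Maurer–Cartan form by `Ad` of the inverse. -/
lemma maurerCartan_tderiv_mul_right (h g : G) (v : E) :
    maurerCartan E (g * h) (tderiv E E (fun x : G => x * h) g v)
      = tderiv E E (fun x : G => h⁻¹ * x * h⁻¹⁻¹) 1 (maurerCartan E g v) := by
  have h1 := tderiv_comp (E := E) (E' := E) (E'' := E) (g := fun x : G => (g * h)⁻¹ * x)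
    (f := fun x : G => x * h) (x := g)
    ((contMDiff_mul_left' (g * h)⁻¹).mdifferentiableAt (by simp))
    ((contMDiff_mul_right' h).mdifferentiableAt (by simp))
  have h2 := tderiv_comp_of_eq (E := E) (E' := E) (E'' := E)
    (g := fun x : G => h⁻¹ * x * h⁻¹⁻¹)
    (f := fun x : G => g⁻¹ * x) (x := g) (y := 1) (inv_mul_cancel g)
    ((contMDiff_conj h⁻¹).mdifferentiableAt (by simp))
    ((contMDiff_mul_left' g⁻¹).mdifferentiableAt (by simp))
  have h3 : (fun x : G => (g * h)⁻¹ * (x * h)) = fun x : G => h⁻¹ * (g⁻¹ * x) * h⁻¹⁻¹ := by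
    ext x; group
  rw [h3, h2] at h1
  exact (DFunLike.congr_fun h1 v).symm

lemma differentiableAt_localForm_maurerCartan :
    DifferentiableAt ℝ (localForm (X := G) (maurerCartan E) 1)
      (extChartAt 𝓘(ℝ, E) (1 : G) 1) := by
  set φ := extChartAt 𝓘(ℝ, E) (1 : G)
  have hφ1 : φ.symm (φ 1) = 1 := extChartAt_to_inv (1 : G)
  let N : E × E → E := fun y => φ ((φ.symm y.1)⁻¹ * φ.symm y.2)
  have hm : ∀ a b, ContMDiffAt 𝓘(ℝ, E) 𝓘(ℝ, E) ∞ φ.symm a →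
      ContMDiffAt 𝓘(ℝ, E) 𝓘(ℝ, E) ∞ φ.symm b →
      ContMDiffAt 𝓘(ℝ, E × E) 𝓘(ℝ, E) ∞
        (fun y : E × E => (φ.symm y.1)⁻¹ * φ.symm y.2) (a, b) := by
    intro a b ha hb
    have h1 : ContMDiffAt 𝓘(ℝ, E × E) 𝓘(ℝ, E) ∞ (fun y : E × E => φ.symm y.1) (a, b) :=
      ContMDiffAt.comp (g := φ.symm) (f := Prod.fst) (a, b) ha
        contDiff_fst.contMDiff.contMDiffAt
    have h2 : ContMDiffAt 𝓘(ℝ, E × E) 𝓘(ℝ, E) ∞ (fun y : E × E => φ.symm y.2) (a, b) :=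
      ContMDiffAt.comp (g := φ.symm) (f := Prod.snd) (a, b) hb
        contDiff_snd.contMDiff.contMDiffAt
    exact h1.inv.mul h2
  have hφe : ∀ᶠ a in 𝓝 (φ 1), ContMDiffAt 𝓘(ℝ, E) 𝓘(ℝ, E) ∞ φ.symm a := by
    filter_upwards [extChartAt_target_mem_nhds (I := 𝓘(ℝ, E)) (1 : G)] with a ha
    exact contMDiffAt_extChartAt_symm_of_mem ha
  have hN : ∀ a, ContMDiffAt 𝓘(ℝ, E) 𝓘(ℝ, E) ∞ φ.symm a → ContDiffAt ℝ ∞ N (a, a) := by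
    intro a ha
    rw [← contMDiffAt_iff_contDiffAt]
    refine ContMDiffAt.comp (g := φ) (a, a) ?_ (hm a a ha ha)
    rw [inv_mul_cancel]
    exact contMDiffAt_extChartAt
  have hloc : localForm (X := G) (maurerCartan E) 1 =ᶠ[𝓝 (φ 1)]
      fun a => (fderiv ℝ N (a, a)).comp (ContinuousLinearMap.inr ℝ E E) := by
    filter_upwards [hφe] with a ha
    change (maurerCartan E (φ.symm a)).comp (tderiv E E φ.symm a) = _
    have h1 : tderiv E E (fun b => (φ.symm a)⁻¹ * φ.symm b) a
        = (maurerCartan E (φ.symm a)).comp (tderiv E E φ.symm a) :=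
      tderiv_comp (g := fun x : G => (φ.symm a)⁻¹ * x)
        ((contMDiff_mul_left' _).mdifferentiableAt (by simp)) (ha.mdifferentiableAt (by simp))
    have h2 : tderiv E E (fun b => N (a, b)) a
        = (tderiv E E φ (1 : G)).comp (tderiv E E (fun b => (φ.symm a)⁻¹ * φ.symm b) a) :=
      tderiv_comp_of_eq (g := φ) (inv_mul_cancel _)
        (mdifferentiableAt_extChartAt (by simp))
        (((contMDiff_mul_left' (φ.symm a)⁻¹).contMDiffAt.comp a ha).mdifferentiableAt (by simp))
    rw [tderiv_extChartAt, ContinuousLinearMap.id_comp, h1, tderiv_eq_fderiv] at h2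
    rw [← h2]
    exact ((((hN a ha).differentiableAt (by simp)).hasFDerivAt).comp (f := fun b => (a, b)) a
      (hasFDerivAt_prodMk_right a a)).fderiv
  refine DifferentiableAt.congr_of_eventuallyEq ?_ hloc
  have h1 : DifferentiableAt ℝ (fderiv ℝ N) (φ 1, φ 1) :=
    ((hN _ (contMDiffAt_extChartAt_symm (1 : G))).fderiv_right (m := 1)
      (by rw [one_add_one_eq_two]; exact ENat.LEInfty.out)).differentiableAt (by simp)
  have h2 : DifferentiableAt ℝ (fun a => fderiv ℝ N (a, a)) (φ 1) :=
    DifferentiableAt.comp (f := fun a => (a, a)) (φ 1) h1 (by fun_prop)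
  exact h2.clm_comp (differentiableAt_const _)

/-- The Maurer–Cartan equation `dμ + ⁅μ, μ⁆ = 0` at the identity. -/
lemma extDer_maurerCartan [CompleteSpace E] (v w : GroupLieAlgebra 𝓘(ℝ, E) G) :
    extDer (F := E) (X := G) (maurerCartan E) 1 v w = (-⁅v, w⁆ : GroupLieAlgebra 𝓘(ℝ, E) G) := by
  set φ := extChartAt 𝓘(ℝ, E) (1 : G)
  have hφ1 : φ.symm (φ 1) = 1 := extChartAt_to_inv (1 : G)
  let M : E → E →L[ℝ] E := localForm (X := G) (maurerCartan E) 1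
  have hM : DifferentiableAt ℝ M (φ 1) := differentiableAt_localForm_maurerCartan
  let Fd : E → E → E := fun v =>
    mpullbackWithin 𝓘(ℝ, E) 𝓘(ℝ, E) φ.symm (mulInvariantVectorField (I := 𝓘(ℝ, E)) (G := G) v)
      (Set.range 𝓘(ℝ, E))
  have hFd : ∀ v, DifferentiableAt ℝ (Fd v) (φ 1) := by
    intro v
    have := (mdifferentiableAt_mulInvariantVectorField (I := 𝓘(ℝ, E)) (G := G) v
      (g := 1)).mdifferentiableWithinAt (s := Set.univ)
      |>.differentiableWithinAt_mpullbackWithin_vectorField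
    have hs : φ.symm ⁻¹' Set.univ ∩ Set.range 𝓘(ℝ, E) = Set.univ := by simp
    rw [hs] at this
    exact differentiableWithinAt_univ.1 this
  have hMF : ∀ v, (fun a => M a (Fd v a)) =ᶠ[𝓝 (φ 1)] fun _ => v := by
    intro v
    filter_upwards [extChartAt_target_mem_nhds (I := 𝓘(ℝ, E)) (1 : G)] with a ha
    have hinv := isInvertible_mfderivWithin_extChartAt_symm ha
    have h1 : (tderiv E E φ.symm a) (Fd v a)
        = tderiv E E (fun x : G => φ.symm a * x) 1 v := by
      have h2 := hinv.self_apply_inverse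
        (mulInvariantVectorField (I := 𝓘(ℝ, E)) (G := G) v (φ.symm a))
      simp only [ModelWithCorners.range_eq_univ, mfderivWithin_univ] at h2
      change (tderiv E E φ.symm a) ((mfderivWithin _ _ _ _ _).inverse _) = _
      simp only [ModelWithCorners.range_eq_univ, mfderivWithin_univ]
      exact h2
    change maurerCartan E (φ.symm a) ((tderiv E E φ.symm a) (Fd v a)) = v
    rw [h1, maurerCartan_tderiv_mul_left]
  have hM1 : M (φ 1) = ContinuousLinearMap.id ℝ E := by
    change (maurerCartan E (φ.symm (φ 1))).comp (tderiv E E φ.symm (φ 1)) = _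
    rw [tderiv_extChartAt_symm, hφ1, maurerCartan]
    simp [tderiv_id]
  have hF1 : ∀ v, Fd v (φ 1) = v := fun v => by
    have := (hMF v).self_of_nhds
    simpa [hM1] using this
  have hprod : ∀ v ζ : E, fderiv ℝ M (φ 1) ζ v + fderiv ℝ (Fd v) (φ 1) ζ = 0 := by
    intro v ζ
    have h1 := ((hM.hasFDerivAt.clm_apply (hFd v).hasFDerivAt).congr_of_eventuallyEq
      (hMF v).symm).unique (hasFDerivAt_const v (φ 1))
    have h2 := DFunLike.congr_fun h1 ζ
    simp only [hM1, hF1] at h2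
    simpa [add_comm] using h2
  have hbr : (⁅v, w⁆ : GroupLieAlgebra 𝓘(ℝ, E) G)
      = fderiv ℝ (Fd w) (φ 1) v - fderiv ℝ (Fd v) (φ 1) w := by
    rw [GroupLieAlgebra.bracket_def, ← mlieBracketWithin_univ, mlieBracketWithin_apply]
    have h1 : (tderiv E E φ (1 : G)).inverse = ContinuousLinearMap.id ℝ E := by
      rw [tderiv_extChartAt, ContinuousLinearMap.inverse_id]
    have hs : φ.symm ⁻¹' Set.univ ∩ Set.range 𝓘(ℝ, E) = Set.univ := by simp
    refine (DFunLike.congr_fun h1 _).trans ?_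
    change lieBracketWithin ℝ (Fd v) (Fd w) (φ.symm ⁻¹' Set.univ ∩ Set.range 𝓘(ℝ, E)) (φ 1) = _
    rw [hs]
    change fderivWithin ℝ (Fd w) Set.univ (φ 1) (Fd v (φ 1))
      - fderivWithin ℝ (Fd v) Set.univ (φ 1) (Fd w (φ 1)) = _
    rw [fderivWithin_univ, fderivWithin_univ]
    exact congrArg₂ (fun a b : E => fderiv ℝ (Fd w) (φ 1) a - fderiv ℝ (Fd v) (φ 1) b)
      (hF1 v) (hF1 w)
  refine (extDer_eq _ _ _ _).trans ?_
  rw [hbr]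
  change fderiv ℝ M (φ 1) v w - fderiv ℝ M (φ 1) w v = _
  have a1 := hprod w v
  have a2 := hprod v w
  rw [eq_neg_of_add_eq_zero_left a1, eq_neg_of_add_eq_zero_left a2]
  exact (neg_sub_neg _ _).trans (neg_sub _ _).symm

/-- Inner automorphisms act on the tangent space at the identity by `Ad`; infinitesimally, `Ad`
acts by the bracket. This follows from the Maurer–Cartan equation, since the Maurer–Cartan form is
equivariant for right translations and constant on the left-invariant vector fields, which are the
fundamental vector fields of right translations. -/
lemma fderiv_Ad_inv [CompleteSpace E] (v : GroupLieAlgebra 𝓘(ℝ, E) G) :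
    DifferentiableAt ℝ (fun a : E => (Ad ((extChartAt 𝓘(ℝ, E) (1 : G)).symm a)⁻¹ v : E))
      (extChartAt 𝓘(ℝ, E) (1 : G) 1) ∧ ∀ w : GroupLieAlgebra 𝓘(ℝ, E) G,
    fderiv ℝ (fun a : E => (Ad ((extChartAt 𝓘(ℝ, E) (1 : G)).symm a)⁻¹ v : E))
      (extChartAt 𝓘(ℝ, E) (1 : G) 1) w = ⁅v, w⁆ := by
  have hmc1 : maurerCartan E (1 : G) = ContinuousLinearMap.id ℝ E := by
    rw [maurerCartan]
    simp [tderiv_id]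
  have h := fun w => extDer_fundamental (EX := E) (X := G) (EH := E) (H := G) (F := E)
    (maurerCartan E) (fun g h => g * h) (contMDiff_mul 𝓘(ℝ, E) ∞) mul_one
    (fun h => tderiv E E (fun x : G => h⁻¹ * x * h⁻¹⁻¹) 1)
    (fun h g ξ => maurerCartan_tderiv_mul_right h g ξ) id
    (fun g A => by rw [mul_one]; exact maurerCartan_tderiv_mul_left g A)
    1 differentiableAt_localForm_maurerCartan v w
  simp only [hmc1, one_mul, tderiv_id] at h
  refine ⟨(h 0).1, fun w => ?_⟩
  have h1 := (h w).2
  have h2 := extDer_maurerCartan (G := G) v w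
  exact neg_injective (h1.symm.trans h2)

variable {E' G' : Type*} [NormedAddCommGroup E'] [NormedSpace ℝ E']
  [TopologicalSpace G'] [ChartedSpace E' G'] [Group G'] [LieGroup 𝓘(ℝ, E') ∞ G']

/-- A smooth homomorphism of Lie groups pulls back the Maurer–Cartan form to the Maurer–Cartan
form, hence its derivative preserves brackets. -/
lemma homDeriv_lie [CompleteSpace E] [CompleteSpace E'] (f : G →* G')
    (hf : ContMDiff 𝓘(ℝ, E) 𝓘(ℝ, E') ∞ f) (v w : GroupLieAlgebra 𝓘(ℝ, E) G) :
    homDeriv E E' f ⁅v, w⁆ = ⁅homDeriv E E' f v, homDeriv E E' f w⁆ := by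
  have h := extDer_map (X := G) (Y := G') (F := E) (F' := E') (maurerCartan E) (maurerCartan E')
    (tderiv E E' f 1) (map_one f) hf.contMDiffAt differentiableAt_localForm_maurerCartan
    differentiableAt_localForm_maurerCartan (.of_forall fun g ξ => ?_) v w
  · have h1 := extDer_maurerCartan (G := G) v w
    have h2 := extDer_maurerCartan (G := G') (homDeriv E E' f v) (homDeriv E E' f w)
    have h3 := h2.symm.trans (h.trans (congrArg (tderiv E E' f 1) h1))
    have h4 : tderiv E E' f 1 (-⁅v, w⁆ : GroupLieAlgebra 𝓘(ℝ, E) G)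
      = -(homDeriv E E' f ⁅v, w⁆ : GroupLieAlgebra 𝓘(ℝ, E') G') := map_neg (homDeriv E E' f) _
    exact (neg_injective (h3.trans h4)).symm
  · have h1 := tderiv_comp (E := E) (E' := E') (E'' := E') (g := fun x : G' => (f g)⁻¹ * x)
      (f := f) (x := g) ((contMDiff_mul_left' (f g)⁻¹).mdifferentiableAt (by simp))
      (hf.mdifferentiableAt (by simp))
    have h2 := tderiv_comp_of_eq (E := E) (E' := E) (E'' := E') (g := f)
      (f := fun x : G => g⁻¹ * x) (x := g) (y := 1) (inv_mul_cancel g)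
      (hf.mdifferentiableAt (by simp)) ((contMDiff_mul_left' g⁻¹).mdifferentiableAt (by simp))
    have h3 : (fun x : G => f (g⁻¹ * x)) = fun x : G => (f g)⁻¹ * f x := by
      ext x; simp
    rw [h3, h1] at h2
    exact DFunLike.congr_fun h2 ξ

end LieGroups

/-! ### Lie subgroups and the adjoint action -/

section Subgroups

variable {E G : Type*} [NormedAddCommGroup E] [NormedSpace ℝ E]
  [TopologicalSpace G] [ChartedSpace E G] [Group G] [LieGroup 𝓘(ℝ, E) ∞ G]
  {EH : Type*} [NormedAddCommGroup EH] [NormedSpace ℝ EH] (H : Subgroup G) [ChartedSpace EH H]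
  [LieGroup 𝓘(ℝ, EH) ∞ H]

lemma Ad_mem_subgroupLieAlgebra (hH : IsClosedLieSubgroup E EH H) (h : H)
    {x : GroupLieAlgebra 𝓘(ℝ, E) G} (hx : x ∈ subgroupLieAlgebra E EH H) :
    Ad (h : G) x ∈ subgroupLieAlgebra E EH H := by
  obtain ⟨A, rfl⟩ := hx
  refine ⟨tderiv EH EH (fun x : H => h * x * h⁻¹) 1 A, ?_⟩
  have h1 := tderiv_comp_of_eq (E := EH) (E' := E) (E'' := E)
    (g := fun x : G => (h : G) * x * (h : G)⁻¹)
    (f := fun x : H => (x : G)) (x := 1) (y := 1) rfl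
    ((contMDiff_conj (h : G)).mdifferentiableAt (by simp))
    (hH.contMDiff.mdifferentiableAt (by simp))
  have h2 := tderiv_comp_of_eq (E := EH) (E' := EH) (E'' := E) (g := fun x : H => (x : G))
    (f := fun x : H => h * x * h⁻¹) (x := 1) (y := 1) (by simp)
    (hH.contMDiff.mdifferentiableAt (by simp))
    ((contMDiff_conj h).mdifferentiableAt (by simp))
  exact (DFunLike.congr_fun h2 A).symm.trans (DFunLike.congr_fun h1 A)

lemma Ad_inv_Ad (g : G) (x : GroupLieAlgebra 𝓘(ℝ, E) G) : Ad g (Ad g⁻¹ x) = x := by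
  have h1 := tderiv_comp_of_eq (E := E) (E' := E) (E'' := E) (g := fun x : G => g * x * g⁻¹)
    (f := fun x : G => g⁻¹ * x * g⁻¹⁻¹) (x := 1) (y := 1) (by simp)
    ((contMDiff_conj g).mdifferentiableAt (by simp))
    ((contMDiff_conj g⁻¹).mdifferentiableAt (by simp))
  have h2 : (fun x : G => g * (g⁻¹ * x * g⁻¹⁻¹) * g⁻¹) = fun x => x := by
    ext x; group
  rw [h2, tderiv_id] at h1
  exact (DFunLike.congr_fun h1 x).symm

variable {H}

/-- The derivative of `h ↦ Ad(h⁻¹) v` along a subgroup. -/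
lemma fderiv_Ad_inv_subgroup [CompleteSpace E] (hH : IsClosedLieSubgroup E EH H)
    (v : GroupLieAlgebra 𝓘(ℝ, E) G) (A : GroupLieAlgebra 𝓘(ℝ, EH) H) :
    fderiv ℝ (fun k : EH => (Ad (((extChartAt 𝓘(ℝ, EH) (1 : H)).symm k : H) : G)⁻¹ v : E))
      (extChartAt 𝓘(ℝ, EH) (1 : H) 1) A = ⁅v, subgroupDeriv H A⁆ := by
  set φ := extChartAt 𝓘(ℝ, E) (1 : G)
  set χ := extChartAt 𝓘(ℝ, EH) (1 : H)
  have hχ1 : χ.symm (χ 1) = 1 := extChartAt_to_inv (1 : H)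
  obtain ⟨h1, h2⟩ := fderiv_Ad_inv (E := E) (G := G) v
  have hs : ContMDiffAt 𝓘(ℝ, EH) 𝓘(ℝ, E) ∞ (fun k => ((χ.symm k : H) : G)) (χ 1) :=
    hH.contMDiff.contMDiffAt.comp (χ 1) (contMDiffAt_extChartAt_symm (1 : H))
  let ι : EH → E := fun k => φ ((χ.symm k : H) : G)
  have hι1 : ι (χ 1) = φ 1 := by simp [ι, hχ1]
  have hι : MDifferentiableAt 𝓘(ℝ, EH) 𝓘(ℝ, E) ι (χ 1) := by
    refine MDifferentiableAt.comp (g := φ) (χ 1) ?_ (hs.mdifferentiableAt (by simp))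
    rw [hχ1]
    exact mdifferentiableAt_extChartAt (by simp)
  have hder : fderiv ℝ ι (χ 1) A = subgroupDeriv H A := by
    have e1 := tderiv_comp_of_eq (E := EH) (E' := E) (E'' := E) (g := φ)
      (f := fun k => ((χ.symm k : H) : G)) (x := χ 1) (y := 1) (by simp [hχ1])
      (mdifferentiableAt_extChartAt (by simp)) (hs.mdifferentiableAt (by simp))
    have e2 := tderiv_comp_of_eq (E := EH) (E' := EH) (E'' := E) (g := fun x : H => (x : G))
      (f := χ.symm) (x := χ 1) (y := 1) hχ1 (hH.contMDiff.mdifferentiableAt (by simp))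
      ((contMDiffAt_extChartAt_symm (1 : H)).mdifferentiableAt (by simp))
    rw [tderiv_extChartAt_symm, ContinuousLinearMap.comp_id] at e2
    rw [tderiv_extChartAt, ContinuousLinearMap.id_comp, e2, tderiv_eq_fderiv] at e1
    exact DFunLike.congr_fun e1 A
  have hev : (fun k : EH => (Ad ((χ.symm k : H) : G)⁻¹ v : E)) =ᶠ[nhds (χ 1)]
      fun k => (Ad (φ.symm (ι k))⁻¹ v : E) := by
    have hc : ∀ᶠ k in nhds (χ 1), ((χ.symm k : H) : G) ∈ φ.source := by
      refine hs.continuousAt.eventually ?_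
      change ∀ᶠ y in nhds ((χ.symm (χ 1) : H) : G), y ∈ φ.source
      rw [hχ1]
      exact extChartAt_source_mem_nhds (I := 𝓘(ℝ, E)) (1 : G)
    filter_upwards [hc] with k hk
    simp only [ι, φ.left_inv hk]
  rw [hev.fderiv_eq]
  have hcomp := HasFDerivAt.comp (E := EH) (F := E) (G := E) (f := ι)
    (g := fun a => (Ad (φ.symm a)⁻¹ v : E)) (χ 1)
    (by rw [hι1]; exact h1.hasFDerivAt) hι.differentiableAt.hasFDerivAt
  have e3 := DFunLike.congr_fun hcomp.fderiv A
  refine e3.trans ?_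
  rw [← h2]
  exact congrArg _ hder

end Subgroups

/-! ### The curvature function of a Cartan connection -/

namespace CartanConnection

variable {E G : Type*} [NormedAddCommGroup E] [NormedSpace ℝ E]
  [TopologicalSpace G] [ChartedSpace E G] [Group G]
  {EH : Type*} [NormedAddCommGroup EH] [NormedSpace ℝ EH] {H : Subgroup G} [ChartedSpace EH H]
  {EM M : Type*} [NormedAddCommGroup EM] [NormedSpace ℝ EM] [TopologicalSpace M]
  [ChartedSpace EM M]
  {EX X : Type*} [NormedAddCommGroup EX] [NormedSpace ℝ EX] [TopologicalSpace X]
  [ChartedSpace EX X]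
  {B : PrincipalBundle EH H EM M EX X} (θ : CartanConnection E B)

lemma form_inv (u : X) (x : GroupLieAlgebra 𝓘(ℝ, E) G) : θ.form u (θ.inv u x) = x :=
  (Equiv.ofBijective (θ.form u) (θ.bijective u)).apply_symm_apply x

lemma inv_eq_iff (u : X) (x : GroupLieAlgebra 𝓘(ℝ, E) G) (ξ : TangentSpace 𝓘(ℝ, EX) u) :
    θ.inv u x = ξ ↔ θ.form u ξ = x := by
  constructor
  · rintro rfl
    exact θ.form_inv u x
  · rintro rfl
    exact (Equiv.ofBijective (θ.form u) (θ.bijective u)).symm_apply_apply ξ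

lemma inv_add (u : X) (x y : GroupLieAlgebra 𝓘(ℝ, E) G) :
    θ.inv u (x + y) = θ.inv u x + θ.inv u y := by
  rw [inv_eq_iff, map_add, form_inv, form_inv]

lemma inv_smul (u : X) (c : ℝ) (x : GroupLieAlgebra 𝓘(ℝ, E) G) :
    θ.inv u (c • x) = c • θ.inv u x := by
  rw [inv_eq_iff, map_smul, form_inv]

/-- The exterior derivative of the Cartan connection, with values in the Lie algebra. -/
def extDerForm (u : X) (ξ η : TangentSpace 𝓘(ℝ, EX) u) : GroupLieAlgebra 𝓘(ℝ, E) G :=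
  extDer (F := E) θ.form u ξ η

lemma extDerForm_neg_swap (u : X) (ξ η : TangentSpace 𝓘(ℝ, EX) u) :
    θ.extDerForm u ξ η = -θ.extDerForm u η ξ :=
  (neg_sub (α := E) _ _).symm

lemma extDerForm_add (u : X) (ξ ξ' η : TangentSpace 𝓘(ℝ, EX) u) :
    θ.extDerForm u (ξ + ξ') η = θ.extDerForm u ξ η + θ.extDerForm u ξ' η := by
  have h : extDer (F := E) θ.form u (ξ + ξ') η
      = extDer (F := E) θ.form u ξ η + extDer (F := E) θ.form u ξ' η := by
    let D : EX →L[ℝ] EX →L[ℝ] E :=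
      fderiv ℝ (localForm (F := E) θ.form u) (extChartAt 𝓘(ℝ, EX) u u)
    let T : EX →L[ℝ] EX := tderiv EX EX (extChartAt 𝓘(ℝ, EX) u) u
    have key : ∀ a a' b : EX,
        D (T (a + a')) (T b) - D (T b) (T (a + a'))
          = (D (T a) (T b) - D (T b) (T a)) + (D (T a') (T b) - D (T b) (T a')) := by
      intro a a' b
      simp only [map_add, add_apply]
      abel
    exact key ξ ξ' η
  exact h

lemma extDerForm_smul (u : X) (c : ℝ) (ξ η : TangentSpace 𝓘(ℝ, EX) u) :
    θ.extDerForm u (c • ξ) η = c • θ.extDerForm u ξ η := by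
  have h : extDer (F := E) θ.form u (c • ξ) η = c • extDer (F := E) θ.form u ξ η := by
    let D : EX →L[ℝ] EX →L[ℝ] E :=
      fderiv ℝ (localForm (F := E) θ.form u) (extChartAt 𝓘(ℝ, EX) u u)
    let T : EX →L[ℝ] EX := tderiv EX EX (extChartAt 𝓘(ℝ, EX) u) u
    have key : ∀ a b : EX, D (T (c • a)) (T b) - D (T b) (T (c • a))
        = c • (D (T a) (T b) - D (T b) (T a)) := by
      intro a b
      simp only [map_smul, smul_apply, smul_sub]
    exact key ξ η
  exact h

lemma curvatureFunction_eq (u : X) (x y : GroupLieAlgebra 𝓘(ℝ, E) G) :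
    θ.curvatureFunction u x y = θ.extDerForm u (θ.inv u x) (θ.inv u y) + ⁅x, y⁆ := by
  change θ.extDerForm u (θ.inv u x) (θ.inv u y)
    + ⁅θ.form u (θ.inv u x), θ.form u (θ.inv u y)⁆ = _
  rw [form_inv, form_inv]

variable [CompleteSpace E] [LieGroup 𝓘(ℝ, E) ∞ G]

lemma curvatureFunction_neg_swap (u : X) (x y : GroupLieAlgebra 𝓘(ℝ, E) G) :
    θ.curvatureFunction u x y = -θ.curvatureFunction u y x := by
  rw [curvatureFunction_eq, curvatureFunction_eq, extDerForm_neg_swap, ← lie_skew, neg_add]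

lemma curvatureFunction_add_left (u : X) (x x' y : GroupLieAlgebra 𝓘(ℝ, E) G) :
    θ.curvatureFunction u (x + x') y = θ.curvatureFunction u x y + θ.curvatureFunction u x' y := by
  simp only [curvatureFunction_eq, inv_add, extDerForm_add, add_lie]
  abel

lemma curvatureFunction_smul_left (u : X) (c : ℝ) (x y : GroupLieAlgebra 𝓘(ℝ, E) G) :
    θ.curvatureFunction u (c • x) y = c • θ.curvatureFunction u x y := by
  simp only [curvatureFunction_eq, inv_smul, extDerForm_smul, smul_lie, smul_add]

/-- The curvature function at a point, as a bilinear map. -/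
def curvatureBilin (u : X) : GroupLieAlgebra 𝓘(ℝ, E) G →ₗ[ℝ] GroupLieAlgebra 𝓘(ℝ, E) G →ₗ[ℝ]
    GroupLieAlgebra 𝓘(ℝ, E) G :=
  LinearMap.mk₂ ℝ (θ.curvatureFunction u) (θ.curvatureFunction_add_left u)
    (θ.curvatureFunction_smul_left u)
    (fun x y y' => by
      rw [curvatureFunction_neg_swap, curvatureFunction_add_left, neg_add,
        ← curvatureFunction_neg_swap, ← curvatureFunction_neg_swap])
    (fun c x y => by
      rw [curvatureFunction_neg_swap, curvatureFunction_smul_left, ← smul_neg,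
        ← curvatureFunction_neg_swap])

lemma curvatureBilin_apply (u : X) (x y : GroupLieAlgebra 𝓘(ℝ, E) G) :
    θ.curvatureBilin u x y = θ.curvatureFunction u x y := rfl

variable [IsManifold 𝓘(ℝ, EX) ∞ X] [LieGroup 𝓘(ℝ, EH) ∞ H]

/-- The curvature is horizontal: it vanishes on fundamental vector fields. Indeed
`dθ(ξ, ζ_A) = -(d/dt) Ad(exp(-tA)) θ(ξ) = -⁅θ(ξ), A⁆`. -/
lemma curvatureFunction_eq_zero_right (hH : IsClosedLieSubgroup E EH H) (u : X)
    (x : GroupLieAlgebra 𝓘(ℝ, E) G) {y : GroupLieAlgebra 𝓘(ℝ, E) G}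
    (hy : y ∈ subgroupLieAlgebra E EH H) : θ.curvatureFunction u x y = 0 := by
  obtain ⟨A, hA⟩ := hy
  replace hA : subgroupDeriv H A = y := hA
  have h := (extDer_fundamental (EX := EX) (X := X) (EH := EH) (H := H) (F := E)
    θ.form B.act B.contMDiff_act B.act_one (fun h => Ad (h : G)⁻¹)
    (fun h u ξ => θ.equivariant h u ξ) (fun A => subgroupDeriv H A)
    (fun u A => θ.fundamental u A) u (θ.smooth.differentiableAt u) (θ.inv u x) A).2
  have hinv : θ.inv u y = tderiv EH EX (fun h => B.act u h) 1 A := by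
    refine (θ.inv_eq_iff u _ _).2 ?_
    have := θ.fundamental u A
    rw [B.act_one] at this
    exact this.trans hA
  have h2 := fderiv_Ad_inv_subgroup hH x A
  have h3 : θ.extDerForm u (θ.inv u x) (θ.inv u y) = -⁅x, y⁆ := by
    rw [hinv, ← hA, ← h2]
    refine h.trans ?_
    exact congrArg (fun z : GroupLieAlgebra 𝓘(ℝ, E) G => -(fderiv ℝ
      (fun k : EH => (Ad (((extChartAt 𝓘(ℝ, EH) (1 : H)).symm k : H) : G)⁻¹ z : E))
      (extChartAt 𝓘(ℝ, EH) (1 : H) 1) A)) (θ.form_inv u x)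
  rw [curvatureFunction_eq, h3, neg_add_cancel]

end CartanConnection

/-! ### The conformal parabolic subalgebra -/

section ConformalParabolic

open Matrix LieAlgebra.Orthogonal

attribute [local instance] LieRing.ofAssociativeRing

variable {Et Gt EPt : Type*} [NormedAddCommGroup Et] [NormedSpace ℝ Et]
  [FiniteDimensional ℝ Et] [TopologicalSpace Gt] [ChartedSpace Et Gt] [Group Gt]
  [LieGroup 𝓘(ℝ, Et) ∞ Gt] [NormedAddCommGroup EPt] [NormedSpace ℝ EPt] {Pt : Subgroup Gt}
  [ChartedSpace EPt Pt] {p q : ℕ}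
  {φ : GroupLieAlgebra 𝓘(ℝ, Et) Gt ≃ₗ⁅ℝ⁆ so' (Fin (p + 1)) (Fin (q + 1)) ℝ}
  {v : Fin (p + 1) ⊕ Fin (q + 1) → ℝ}

lemma IsConformalParabolic.lie_mem (hPt : IsConformalParabolic (EPt := EPt) Pt p q φ v)
    {x y : GroupLieAlgebra 𝓘(ℝ, Et) Gt} (hx : x ∈ subgroupLieAlgebra Et EPt Pt)
    (hy : y ∈ subgroupLieAlgebra Et EPt Pt) : ⁅x, y⁆ ∈ subgroupLieAlgebra Et EPt Pt := by
  obtain ⟨c, hc⟩ := (hPt.mem_iff x).1 hx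
  obtain ⟨d, hd⟩ := (hPt.mem_iff y).1 hy
  refine (hPt.mem_iff _).2 ⟨0, ?_⟩
  rw [LieEquiv.map_lie, LieSubalgebra.coe_bracket, Ring.lie_def, sub_mulVec, ← mulVec_mulVec,
    ← mulVec_mulVec, hc, hd, mulVec_smul, mulVec_smul, hc, hd, smul_smul, smul_smul, mul_comm c d,
    sub_self, zero_smul]

lemma IsConformalParabolic.eq_top (hPt : IsConformalParabolic (EPt := EPt) Pt p q φ v)
    (hp : p = 0) (hq : q = 0) : subgroupLieAlgebra Et EPt Pt = ⊤ := by
  subst hp hq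
  exact eq_top_iff.2 fun x _ => (hPt.mem_iff x).2
    (exists_mulVec_eq_smul_of_one_one hPt.null (φ x))

lemma isKilling_of_equiv_so' (φ : GroupLieAlgebra 𝓘(ℝ, Et) Gt ≃ₗ⁅ℝ⁆
      so' (Fin (p + 1)) (Fin (q + 1)) ℝ) (hpq : 0 < p + q) :
    LieAlgebra.IsKilling ℝ (GroupLieAlgebra 𝓘(ℝ, Et) Gt) := by
  have : LieAlgebra.IsKilling ℝ (so' (Fin (p + 1)) (Fin (q + 1)) ℝ) :=
    isKilling_skewAdjoint (transpose_indefiniteDiagonal _ _) (indefiniteDiagonal_mul_self _ _)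
      (by simp; omega)
  exact LieAlgebra.isKilling_of_equiv φ.symm

/-- `⁅𝔭̃^⊥, 𝔤̃⁆ ⊆ 𝔭̃`, because the conformal grading of `𝔤̃` has length one. -/
lemma IsConformalParabolic.lie_mem_of_orthogonal
    (hPt : IsConformalParabolic (EPt := EPt) Pt p q φ v) (hpq : 0 < p + q)
    (z : GroupLieAlgebra 𝓘(ℝ, Et) Gt)
    (hz : ∀ y ∈ subgroupLieAlgebra Et EPt Pt,
      killingForm ℝ (GroupLieAlgebra 𝓘(ℝ, Et) Gt) z y = 0)
    (x : GroupLieAlgebra 𝓘(ℝ, Et) Gt) : ⁅z, x⁆ ∈ subgroupLieAlgebra Et EPt Pt := by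
  have hJt := transpose_indefiniteDiagonal (Fin (p + 1)) (Fin (q + 1))
  have hJJ := indefiniteDiagonal_mul_self (Fin (p + 1)) (Fin (q + 1))
  refine (hPt.mem_iff _).2 ?_
  rw [LieEquiv.map_lie]
  refine exists_lie_mulVec_eq_smul hJt hJJ hPt.ne_zero hPt.null (φ z) (fun y hy => ?_) (φ x)
  obtain ⟨y, rfl⟩ := φ.surjective y
  have h1 := hz y ((hPt.mem_iff _).2 hy)
  rw [← LieAlgebra.killingForm_of_equiv_apply φ] at h1
  have h2 := (killingForm_skewAdjoint hJt hJJ (φ z) (φ y)).symm.trans h1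
  refine (mul_eq_zero.1 h2).resolve_left ?_
  have : (0 : ℝ) < (p : ℝ) + q := by exact_mod_cast hpq
  simp only [Fintype.card_sum, Fintype.card_fin]
  push_cast
  linarith

end ConformalParabolic

/-! ### Curvature of the induced Cartan geometry -/

section Induced

variable {E G : Type*} [NormedAddCommGroup E] [NormedSpace ℝ E]
  [TopologicalSpace G] [ChartedSpace E G] [Group G]
  {Et Gt : Type*} [NormedAddCommGroup Et] [NormedSpace ℝ Et]
  [TopologicalSpace Gt] [ChartedSpace Et Gt] [Group Gt]
  {EP : Type*} [NormedAddCommGroup EP] [NormedSpace ℝ EP] {P : Subgroup G} [ChartedSpace EP P]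
  {EPt : Type*} [NormedAddCommGroup EPt] [NormedSpace ℝ EPt] {Pt : Subgroup Gt}
  [ChartedSpace EPt Pt]
  {EM M : Type*} [NormedAddCommGroup EM] [NormedSpace ℝ EM] [TopologicalSpace M]
  [ChartedSpace EM M]
  {EX X : Type*} [NormedAddCommGroup EX] [NormedSpace ℝ EX] [TopologicalSpace X]
  [ChartedSpace EX X]
  {i : G →* Gt} {hQP : Pt.comap i ≤ P}
  {EQ : Type*} [NormedAddCommGroup EQ] [NormedSpace ℝ EQ] [ChartedSpace EQ (Pt.comap i)]
  {B : PrincipalBundle EP P EM M EX X} {θ : CartanConnection E B}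
  {EMt Mt : Type*} [NormedAddCommGroup EMt] [NormedSpace ℝ EMt] [TopologicalSpace Mt]
  [ChartedSpace EMt Mt]
  {EXt Xt : Type*} [NormedAddCommGroup EXt] [NormedSpace ℝ EXt] [TopologicalSpace Xt]
  [ChartedSpace EXt Xt]
  (Φ : FeffermanSpace (EPt := EPt) i hQP EQ θ Et EMt Mt EXt Xt)

/-- The homomorphism `g ↦ h⁻¹ i(g) h`, which plays the role of `i` at the points `quot(u, h)` of
the induced bundle. -/
def conjHom (i : G →* Gt) (h : Gt) : G →* Gt := (MulAut.conj h⁻¹).toMonoidHom.comp i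

lemma contMDiff_conjHom [LieGroup 𝓘(ℝ, Et) ∞ Gt] (hi : IsLieGroupInclusion E Et i) (h : Gt) :
    ContMDiff 𝓘(ℝ, E) 𝓘(ℝ, Et) ∞ (conjHom i h) :=
  (contMDiff_conj h⁻¹).comp hi.contMDiff

lemma homDeriv_conjHom [LieGroup 𝓘(ℝ, Et) ∞ Gt] (hi : IsLieGroupInclusion E Et i) (h : Gt)
    (x : GroupLieAlgebra 𝓘(ℝ, E) G) :
    homDeriv E Et (conjHom i h) x = Ad h⁻¹ (homDeriv E Et i x) := by
  have h1 := tderiv_comp_of_eq (E := E) (E' := Et) (E'' := Et)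
    (g := fun x : Gt => h⁻¹ * x * h⁻¹⁻¹) (f := i) (x := 1) (y := 1) (map_one i)
    ((contMDiff_conj h⁻¹).mdifferentiableAt (by simp)) (hi.contMDiff.mdifferentiableAt (by simp))
  exact DFunLike.congr_fun h1 x

lemma injective_homDeriv_conjHom [LieGroup 𝓘(ℝ, Et) ∞ Gt] (hi : IsLieGroupInclusion E Et i)
    (h : Gt) : Function.Injective (homDeriv E Et (conjHom i h)) := by
  intro x y hxy
  rw [homDeriv_conjHom hi, homDeriv_conjHom hi] at hxy
  have h1 := congrArg (Ad h) hxy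
  rw [Ad_inv_Ad, Ad_inv_Ad] at h1
  exact hi.injective_mfderiv 1 h1

lemma contMDiff_quot_left (h : Pt) :
    ContMDiff 𝓘(ℝ, EX) 𝓘(ℝ, EXt) ∞ (fun w => Φ.quot (w, h)) :=
  Φ.contMDiff_quot.comp (contMDiff_id.prodMk contMDiff_const)

/-- The restriction of the induced connection to `X × {h}`. -/
lemma conn_form_tderiv_quot_left [LieGroup 𝓘(ℝ, Et) ∞ Gt] (hi : IsLieGroupInclusion E Et i)
    (u : X) (h : Pt) (ξ : EX) :
    (Φ.conn.form (Φ.quot (u, h)) : EXt →L[ℝ] GroupLieAlgebra 𝓘(ℝ, Et) Gt)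
        (tderiv EX EXt (fun w => Φ.quot (w, h)) u ξ)
      = homDeriv E Et (conjHom i (h : Gt)) (θ.form u ξ) := by
  have h1 : (fun w => Φ.quot (w, h)) = fun w => Φ.bundle.act (Φ.quot (w, 1)) h := by
    ext w
    rw [Φ.act_quot, one_mul]
  have hact : ContMDiff 𝓘(ℝ, EXt) 𝓘(ℝ, EXt) ∞ fun z => Φ.bundle.act z h :=
    Φ.bundle.contMDiff_act.comp (contMDiff_id.prodMk contMDiff_const)
  have h2 := tderiv_comp (E := EX) (E' := EXt) (E'' := EXt) (x := u)
    (g := fun z => Φ.bundle.act z h) (f := fun w => Φ.quot (w, 1))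
    (hact.mdifferentiableAt (by simp)) ((contMDiff_quot_left Φ 1).mdifferentiableAt (by simp))
  have h3 := (Φ.conn.equivariant h (Φ.quot (u, 1))
    (tderiv EX EXt (fun w => Φ.quot (w, 1)) u ξ)).trans
    (congrArg (Ad (h : Gt)⁻¹) (Φ.conn_restrict u ξ))
  rw [homDeriv_conjHom hi, ← h3, h1, h2, Φ.act_quot, one_mul]
  rfl

/-- The directions of the factor `Pt` in `X × Pt` are fundamental on the induced bundle. -/
lemma conn_form_tderiv_quot_right [LieGroup 𝓘(ℝ, EPt) ∞ Pt] (u : X) (h : Pt) (A : EPt) :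
    (Φ.conn.form (Φ.quot (u, h)) : EXt →L[ℝ] GroupLieAlgebra 𝓘(ℝ, Et) Gt)
        (tderiv EPt EXt (fun k => Φ.quot (u, k)) h A) ∈ subgroupLieAlgebra Et EPt Pt := by
  have h1 : (fun k => Φ.quot (u, k)) = fun k => Φ.bundle.act (Φ.quot (u, h)) (h⁻¹ * k) := by
    ext k
    rw [Φ.act_quot, mul_inv_cancel_left]
  have hact : ContMDiff 𝓘(ℝ, EPt) 𝓘(ℝ, EXt) ∞ fun k => Φ.bundle.act (Φ.quot (u, h)) k :=
    Φ.bundle.contMDiff_act.comp (contMDiff_const.prodMk contMDiff_id)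
  have h2 := tderiv_comp_of_eq (E := EPt) (E' := EPt) (E'' := EXt) (x := h) (y := 1)
    (g := fun k => Φ.bundle.act (Φ.quot (u, h)) k) (f := fun k => h⁻¹ * k) (inv_mul_cancel h)
    (hact.mdifferentiableAt (by simp)) ((contMDiff_mul_left' h⁻¹).mdifferentiableAt (by simp))
  have h3 := Φ.conn.fundamental (Φ.quot (u, h)) (tderiv EPt EPt (fun k => h⁻¹ * k) h A)
  rw [Φ.bundle.act_one] at h3
  rw [h1, h2]
  exact ⟨_, h3.symm⟩

/-- Since `X × Pt → Xt` is a submersion, `𝔤̃` is the sum of `𝔤` and `𝔭̃`. -/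
lemma exists_eq_homDeriv_add [LieGroup 𝓘(ℝ, Et) ∞ Gt] [LieGroup 𝓘(ℝ, EPt) ∞ Pt]
    (Φ : FeffermanSpace (EPt := EPt) i hQP EQ θ Et EMt Mt EXt Xt)
    (hi : IsLieGroupInclusion E Et i) (u : X) (h : Pt) (z : GroupLieAlgebra 𝓘(ℝ, Et) Gt) :
    ∃ x : GroupLieAlgebra 𝓘(ℝ, E) G, ∃ y ∈ subgroupLieAlgebra Et EPt Pt,
      z = homDeriv E Et (conjHom i (h : Gt)) x + y := by
  obtain ⟨ζ, hζ⟩ := Φ.surjective_mfderiv_quot (u, h) (Φ.conn.inv (Φ.quot (u, h)) z)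
  have hsum : (Φ.conn.inv (Φ.quot (u, h)) z : EXt)
      = tderiv EX EXt (fun w => Φ.quot (w, h)) u ζ.1
        + tderiv EPt EXt (fun k => Φ.quot (u, k)) h ζ.2 :=
    hζ.symm.trans (mfderiv_prod_eq_add_apply (Φ.contMDiff_quot.mdifferentiableAt (by simp)))
  refine ⟨θ.form u ζ.1, _, conn_form_tderiv_quot_right Φ u h ζ.2, ?_⟩
  rw [← conn_form_tderiv_quot_left Φ hi u h ζ.1]
  refine (Φ.conn.form_inv (Φ.quot (u, h)) z).symm.trans ?_
  exact (congrArg (Φ.conn.form (Φ.quot (u, h))) hsum).trans (map_add _ _ _)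

/-- The curvature of the induced connection restricts to the curvature of the original one. -/
lemma curvatureFunction_quot [CompleteSpace E] [CompleteSpace Et] [LieGroup 𝓘(ℝ, E) ∞ G]
    [LieGroup 𝓘(ℝ, Et) ∞ Gt] [IsManifold 𝓘(ℝ, EX) ∞ X] [IsManifold 𝓘(ℝ, EXt) ∞ Xt]
    (hi : IsLieGroupInclusion E Et i) (u : X) (h : Pt) (x y : GroupLieAlgebra 𝓘(ℝ, E) G) :
    Φ.conn.curvatureFunction (Φ.quot (u, h)) (homDeriv E Et (conjHom i (h : Gt)) x)
        (homDeriv E Et (conjHom i (h : Gt)) y)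
      = homDeriv E Et (conjHom i (h : Gt)) (θ.curvatureFunction u x y) := by
  have hinv : ∀ x, Φ.conn.inv (Φ.quot (u, h)) (homDeriv E Et (conjHom i (h : Gt)) x)
      = tderiv EX EXt (fun w => Φ.quot (w, h)) u (θ.inv u x) := by
    intro x
    refine (Φ.conn.inv_eq_iff _ _ _).2 ?_
    exact (conn_form_tderiv_quot_left Φ hi u h _).trans (congrArg _ (θ.form_inv u x))
  have hd := extDer_map (F := E) (F' := Et) θ.form Φ.conn.form (homDeriv E Et (conjHom i (h : Gt)))
    (j := fun w => Φ.quot (w, h)) (x := u) rfl (contMDiff_quot_left Φ h).contMDiffAt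
    (θ.smooth.differentiableAt u) (Φ.conn.smooth.differentiableAt _)
    (.of_forall fun w ξ => conn_form_tderiv_quot_left Φ hi w h ξ) (θ.inv u x) (θ.inv u y)
  have hd' : Φ.conn.extDerForm (Φ.quot (u, h))
      (tderiv EX EXt (fun w => Φ.quot (w, h)) u (θ.inv u x))
      (tderiv EX EXt (fun w => Φ.quot (w, h)) u (θ.inv u y))
      = homDeriv E Et (conjHom i (h : Gt)) (θ.extDerForm u (θ.inv u x) (θ.inv u y)) := hd
  rw [Φ.conn.curvatureFunction_eq, θ.curvatureFunction_eq, hinv, hinv, hd', map_add,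
    homDeriv_lie _ (contMDiff_conjHom hi (h : Gt))]

end Induced

end Fefferman

end

theorem mainTheorem5
    -- the Lie groups `G` and `Gt`
    {E G : Type*} [NormedAddCommGroup E] [NormedSpace ℝ E] [FiniteDimensional ℝ E]
    [TopologicalSpace G] [ChartedSpace E G] [Group G] [LieGroup 𝓘(ℝ, E) ∞ G]
    {Et Gt : Type*} [NormedAddCommGroup Et] [NormedSpace ℝ Et] [FiniteDimensional ℝ Et]
    [TopologicalSpace Gt] [ChartedSpace Et Gt] [Group Gt] [LieGroup 𝓘(ℝ, Et) ∞ Gt]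
    -- the subgroups `P` of `G` and `Pt` of `Gt`, and the inclusion `i`; `Q` is `Pt.comap i`
    {EP : Type*} [NormedAddCommGroup EP] [NormedSpace ℝ EP]
    (P : Subgroup G) [ChartedSpace EP P] [LieGroup 𝓘(ℝ, EP) ∞ P]
    {EPt : Type*} [NormedAddCommGroup EPt] [NormedSpace ℝ EPt]
    (Pt : Subgroup Gt) [ChartedSpace EPt Pt] [LieGroup 𝓘(ℝ, EPt) ∞ Pt]
    (i : G →* Gt)
    {EQ : Type*} [NormedAddCommGroup EQ] [NormedSpace ℝ EQ]
    [ChartedSpace EQ (Pt.comap i)] [LieGroup 𝓘(ℝ, EQ) ∞ (Pt.comap i)]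
    (hi : Fefferman.IsLieGroupInclusion E Et i)
    -- `Gt` has Lie algebra `𝔰𝔬(p+1, q+1)`, and `Pt` belongs to the null line through `v`
    (p q : ℕ)
    (φ : GroupLieAlgebra 𝓘(ℝ, Et) Gt ≃ₗ⁅ℝ⁆
      LieAlgebra.Orthogonal.so' (Fin (p + 1)) (Fin (q + 1)) ℝ)
    (v : Fin (p + 1) ⊕ Fin (q + 1) → ℝ)
    (hPt : Fefferman.IsConformalParabolic (EPt := EPt) Pt p q φ v)
    -- `G` is semisimple, and `P` is a parabolic subgroup
    (hG : LieAlgebra.IsSemisimple ℝ (GroupLieAlgebra 𝓘(ℝ, E) G))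
    (gr : ℤ → Submodule ℝ (GroupLieAlgebra 𝓘(ℝ, E) G))
    (hgr : Fefferman.IsParabolicGrading gr)
    (hP : Fefferman.IsClosedLieSubgroup E EP P)
    (hPgr : Fefferman.subgroupLieAlgebra E EP P = Fefferman.filt gr 0)
    -- `P` contains `Q`, and the `G`-orbit of the base point is open in `Gt / Pt`
    (hQ : Fefferman.IsClosedLieSubgroup E EQ (Pt.comap i))
    (hQP : Pt.comap i ≤ P)
    (horbit : IsOpen (Set.range fun g : G => (i g : Gt ⧸ Pt)))
    -- the Killing form of `Gt` restricts to a non-zero multiple of that of `G`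
    (hKilling : ∃ c : ℝ, c ≠ 0 ∧ ∀ x y : GroupLieAlgebra 𝓘(ℝ, E) G,
      killingForm ℝ (GroupLieAlgebra 𝓘(ℝ, Et) Gt)
        (Fefferman.homDeriv E Et i x) (Fefferman.homDeriv E Et i y)
      = c * killingForm ℝ (GroupLieAlgebra 𝓘(ℝ, E) G) x y)
    -- the parabolic geometry `(X → M, θ)` of type `(G, P)`
    {EM M : Type*} [NormedAddCommGroup EM] [NormedSpace ℝ EM] [TopologicalSpace M]
    [ChartedSpace EM M] [IsManifold 𝓘(ℝ, EM) ∞ M]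
    {EX X : Type*} [NormedAddCommGroup EX] [NormedSpace ℝ EX] [TopologicalSpace X]
    [ChartedSpace EX X] [IsManifold 𝓘(ℝ, EX) ∞ X]
    (B : Fefferman.PrincipalBundle EP P EM M EX X)
    (θ : Fefferman.CartanConnection E B)
    (hreg : θ.IsRegular gr)
    (hnor : θ.IsNormal)
    (hcurv : ∀ (u : X) (x y : GroupLieAlgebra 𝓘(ℝ, E) G),
      Fefferman.homDeriv E Et i (θ.curvatureFunction u x y)
        ∈ Fefferman.subgroupLieAlgebra Et EPt Pt)
    (hone : ∀ (u : X) (x : GroupLieAlgebra 𝓘(ℝ, E) G),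
      Fefferman.codiffOne (Fefferman.subgroupLieAlgebra E EP P) (θ.curvatureFunction u) x = 0)
    (htwo : ∀ (u : X) (x : GroupLieAlgebra 𝓘(ℝ, E) G),
      Fefferman.codiffTwo (Fefferman.subgroupLieAlgebra E EP P) (θ.curvatureFunction u) x = 0)
    -- the induced conformal parabolic geometry
    {EMt Mt : Type*} [NormedAddCommGroup EMt] [NormedSpace ℝ EMt] [TopologicalSpace Mt]
    [ChartedSpace EMt Mt] [IsManifold 𝓘(ℝ, EMt) ∞ Mt]
    {EXt Xt : Type*} [NormedAddCommGroup EXt] [NormedSpace ℝ EXt] [TopologicalSpace Xt]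
    [ChartedSpace EXt Xt] [IsManifold 𝓘(ℝ, EXt) ∞ Xt]
    (Φ : Fefferman.FeffermanSpace (EPt := EPt) i hQP EQ θ Et EMt Mt EXt Xt) :
    Φ.conn.IsNormal := by
  rcases Nat.eq_zero_or_pos (p + q) with hpq | hpq
  · -- In signature `(1, 1)` the subgroup `Pt` has full Lie algebra.
    intro w x
    rw [hPt.eq_top (by omega) (by omega)]
    exact Fefferman.codiff_top _ x
  intro w x'
  obtain ⟨⟨u, h⟩, rfl⟩ := Φ.surjective_quot w
  have hkG : LieAlgebra.IsKilling ℝ (GroupLieAlgebra 𝓘(ℝ, E) G) := inferInstance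
  have hkGt : LieAlgebra.IsKilling ℝ (GroupLieAlgebra 𝓘(ℝ, Et) Gt) :=
    Fefferman.isKilling_of_equiv_so' φ hpq
  let f := Fefferman.conjHom i (h : Gt)
  let ρ : GroupLieAlgebra 𝓘(ℝ, E) G →ₗ⁅ℝ⁆ GroupLieAlgebra 𝓘(ℝ, Et) Gt :=
    { (Fefferman.homDeriv E Et f : GroupLieAlgebra 𝓘(ℝ, E) G →ₗ[ℝ] GroupLieAlgebra 𝓘(ℝ, Et) Gt) with
      map_lie' := Fefferman.homDeriv_lie f (Fefferman.contMDiff_conjHom hi (h : Gt)) _ _ }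
  refine Fefferman.codiff_eq_zero_of_restrict (Fefferman.subgroupLieAlgebra E EP P)
    (Fefferman.subgroupLieAlgebra Et EPt Pt) ρ
    (Fefferman.injective_homDeriv_conjHom hi (h : Gt))
    (Fefferman.exists_eq_homDeriv_add Φ hi u h)
    (fun x hx y hy => hPt.lie_mem hx hy) (hPt.lie_mem_of_orthogonal hpq)
    (θ.curvatureBilin u) (Φ.conn.curvatureBilin (Φ.quot (u, h)))
    (fun x hx y => ?_) (fun x hx y => ?_) (Φ.conn.curvatureFunction_neg_swap _)
    (Fefferman.curvatureFunction_quot Φ hi u h) (fun x y => ?_) (hone u) x'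
  · rw [θ.curvatureBilin_apply, θ.curvatureFunction_neg_swap,
      θ.curvatureFunction_eq_zero_right hP u y hx, neg_zero]
  · rw [Φ.conn.curvatureBilin_apply, Φ.conn.curvatureFunction_neg_swap,
      Φ.conn.curvatureFunction_eq_zero_right hPt.closed _ y hx, neg_zero]
  · have hval := Fefferman.Ad_mem_subgroupLieAlgebra Pt hPt.closed h⁻¹ (hcurv u x y)
    exact (Fefferman.homDeriv_conjHom hi (h : Gt) _).symm ▸ hval
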